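/- Let $B$ be a field of characteristic $0$ and let $G\subset B^\times$ be a finitely generated subgroup which contains an element of infinite order and in which $t^4=1$ holds only for $t=1$. Write $d(t)=\frac{1}{t^2-t^{-2}}$. Let $m,n$ be integers and let $L$ be the oriented Hopf link in $S^3$ with linking number $-1$ and framings $m$ and $n$, so that its linking matrix is $\begin{pmatrix} m&-1\\-1&n\end{pmatrix}$. Surgery along $L$ gives the lens space $L(mn-1,n)$ (the union of two solid tori in which the meridian of the second is glued to a curve running $n$ times along the meridian and $mn-1$ times along the core of the first; in particular $L(0,\pm1)=S^2\times S^1$ and $L(\pm1,n)=S^3$). Let $\omega:H_1(L(mn-1,n),\mathbb Z)\to G$ be a homomorphism, and put $u=\omega([m_1])$, $v=\omega([m_2])$, where $m_1,m_2$ are the oriented meridians of the components of $L$ with framings $m$ and $n$. Suppose that $u\neq1$ and $v\neq1$ (that is, $L$ is computable for $\omega$). For a framed oriented link whose components are colored by pairs $(t,N)\in G\times\mathbb Z$ with $t^4\ne1$, let $\Delta$ denote Viro's $\mathfrak{gl}(1|1)$-Alexander polynomial: cut a diagram with blackboard framing open at a point, on an edge of color $(t,N)$ next to the unbounded region, apply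 Viro's functor (the state sum with his Boltzmann weights), and multiply the resulting scalar by $(t^2-t^{-2})^{-1}$. Extend $\Delta$ multilinearly to components $K$ with Kirby color $\Omega(t,N)$, which stands for $d(t)$ times $K$ colored by $(t,N)$ minus $d(t)$ times the reversed component $-K$ colored by $(t^{-1},2-N)$. Let $$\Delta(L(mn-1,n),\omega)=\frac{\Delta(L)}{2^{2}(-1)^{\sigma_+(L)}},$$ where the components of $L$ have the Kirby colors $\Omega(u,1)$ and $\Omega(v,1)$ and $\sigma_+(L)$ is the number of positive eigenvalues of the linking matrix of $L$. Then $$\Delta(L(mn-1,n),\omega)=(-1)^{\sigma_+(L)+1}\,d(u)\,d(v).$$ -/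

import Mathlib

noncomputable section

namespace GlAlexander

/-! ## Palettes and colors -/

/-- The standing assumptions on the group `G` of multiplicities of a 1-palette `(B, G)`:
`G` is a finitely generated subgroup of the multiplicative group of `B`, it contains a copy of
`ℤ`, and `t ^ 4 = 1` only for `t = 1` in `G`. -/
structure IsGoodPalette {B : Type*} [Field B] (G : Subgroup Bˣ) : Prop where
  fg : G.FG
  exists_infinite_order : ∃ g ∈ G, ¬ IsOfFinOrder g
  eq_one_of_pow_four : ∀ t ∈ G, t ^ 4 = 1 → t = 1

/-- A color `(t, N)`: a multiplicity `t` and an integer weight `N`. -/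
structure Color (B : Type*) [Field B] where
  mul : Bˣ
  wt : ℤ

/-- `d(t) = 1 / (t² - t⁻²)`. -/
def d {B : Type*} [Field B] (t : B) : B := 1 / (t ^ 2 - t ^ (-2 : ℤ))

/-! ## Oriented link diagrams in Morse position, cut open at one point

A diagram is read from the bottom to the top. It is divided into slices, each of which contains
exactly one critical point or crossing besides vertical segments. The components are labelled
by `ι`. Positions are counted from the left, starting with `0`. The framing is the blackboard
framing. -/

/-- An endpoint of a strand at some height: its component, and whether it is directed upward. -/
structure Strand (ι : Type*) where
  comp : ι
  up : Bool

/-- A slice: `cup p k up` is a minimum on component `k` which creates two endpoints at the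
positions `p` and `p + 1`, the left one being directed upward if and only if `up = true`; `cap p`
is a maximum joining the endpoints at `p` and `p + 1`; `cross p lrOver` is a crossing of the strands
at `p` and `p + 1`, in which the strand going from bottom left to top right is the
overcrossing strand if and only if `lrOver = true`. -/
inductive Slice (ι : Type*) where
  | cup (p : ℕ) (k : ι) (up : Bool)
  | cap (p : ℕ)
  | cross (p : ℕ) (lrOver : Bool)

/-- The endpoints above a slice, in terms of those below. -/
def Slice.next {ι : Type*} : Slice ι → List (Strand ι) → List (Strand ι)
  | .cup p k up, S => S.take p ++ ⟨k, up⟩ :: ⟨k, !up⟩ :: S.drop p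
  | .cap p, S => S.take p ++ S.drop (p + 2)
  | .cross p _, S =>
    match S.drop p with
    | a :: b :: R => S.take p ++ b :: a :: R
    | _ => S

/-- The slice can be put on top of the given endpoints, respecting components and
orientations. -/
def Slice.Fits {ι : Type*} : Slice ι → List (Strand ι) → Prop
  | .cup p _ _, S => p ≤ S.length
  | .cap p, S => ∃ a b R, S.drop p = a :: b :: R ∧ a.comp = b.comp ∧ b.up = !a.up
  | .cross p _, S => p + 2 ≤ S.length

/-- The slices, from the bottom to the top, form a diagram with endpoints `S` at the bottom and
`T` at the top. -/
def Joins {ι : Type*} : List (Slice ι) → List (Strand ι) → List (Strand ι) → Prop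
  | [], S, T => S = T
  | s :: w, S, T => s.Fits S ∧ Joins w (s.next S) T

/-- An oriented framed link diagram in Morse position, cut open at a point of the component
`cut.comp` next to the unbounded region, so that it has one endpoint at the bottom and one at the
top. -/
structure LinkDiagram (ι : Type*) where
  cut : Strand ι
  slices : List (Slice ι)
  joins : Joins slices [cut] [cut]

/-- Reverse the orientation of the components `k` with `ε k = true`. -/
def Strand.reverse {ι : Type*} (ε : ι → Bool) (a : Strand ι) : Strand ι :=
  ⟨a.comp, xor a.up (ε a.comp)⟩

/-- Reverse the orientation of the components `k` with `ε k = true`. -/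
def Slice.reverse {ι : Type*} (ε : ι → Bool) : Slice ι → Slice ι
  | .cup p k up => .cup p k (xor up (ε k))
  | .cap p => .cap p
  | .cross p lrOver => .cross p lrOver

theorem Slice.next_reverse {ι : Type*} (ε : ι → Bool) (s : Slice ι) (S : List (Strand ι)) :
    (s.reverse ε).next (S.map (Strand.reverse ε)) = (s.next S).map (Strand.reverse ε) := by
  cases s with
  | cup p k up => simp [Slice.reverse, Slice.next, Strand.reverse]
  | cap p => simp [Slice.reverse, Slice.next]
  | cross p lrOver =>
    simp only [Slice.reverse, Slice.next, ← List.map_drop, ← List.map_take]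
    rcases S.drop p with _ | ⟨a, _ | ⟨b, R⟩⟩ <;> simp

theorem Slice.fits_reverse {ι : Type*} (ε : ι → Bool) (s : Slice ι) (S : List (Strand ι))
    (h : s.Fits S) : (s.reverse ε).Fits (S.map (Strand.reverse ε)) := by
  cases s with
  | cup p k up => simpa [Slice.reverse, Slice.Fits] using h
  | cap p =>
    obtain ⟨a, b, R, h1, h2, h3⟩ := h
    refine ⟨a.reverse ε, b.reverse ε, R.map (Strand.reverse ε), ?_, h2, ?_⟩
    · rw [← List.map_drop, h1]; rfl
    · simp [Strand.reverse, h2, h3]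
  | cross p lrOver => simpa [Slice.reverse, Slice.Fits] using h

theorem joins_reverse {ι : Type*} (ε : ι → Bool) (w : List (Slice ι)) :
    ∀ S T : List (Strand ι), Joins w S T →
      Joins (w.map (Slice.reverse ε)) (S.map (Strand.reverse ε)) (T.map (Strand.reverse ε)) := by
  induction w with
  | nil => intro S T h; exact congrArg _ h
  | cons s w ih =>
    intro S T h
    refine ⟨s.fits_reverse ε S h.1, ?_⟩
    rw [s.next_reverse]
    exact ih _ _ h.2

/-- The same diagram with the orientation of the components `k` with `ε k = true` reversed. -/
def LinkDiagram.reverse {ι : Type*} (D : LinkDiagram ι) (ε : ι → Bool) : LinkDiagram ι where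
  cut := D.cut.reverse ε
  slices := D.slices.map (Slice.reverse ε)
  joins := joins_reverse ε D.slices [D.cut] [D.cut] D.joins

/-! ## Linking matrix -/

/-- Sum of the signs of the crossings between the components `i` and `j`. A crossing of two
strands which are both directed upward, or both downward, is positive if and only if the strand
from bottom left to top right is the overcrossing one. -/
def signSum {ι : Type*} [DecidableEq ι] (i j : ι) : List (Slice ι) → List (Strand ι) → ℤ
  | [], _ => 0
  | s :: w, S =>
    (match s, S with
      | .cross p lrOver, S =>
        match S.drop p with
        | a :: b :: _ =>
          if (a.comp = i ∧ b.comp = j) ∨ (a.comp = j ∧ b.comp = i) then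
            (if lrOver then 1 else -1) * (if a.up = b.up then 1 else -1)
          else 0
        | _ => 0
      | _, _ => 0) + signSum i j w (s.next S)

/-- The linking matrix of a framed link diagram: off the diagonal half of the sum of the signs of
the crossings between two components, on the diagonal the sum of the signs of the
self-crossings (the framing). -/
def LinkDiagram.linkingMatrix {ι : Type*} [DecidableEq ι] (D : LinkDiagram ι) : Matrix ι ι ℤ :=
  Matrix.of fun i j =>
    if i = j then signSum i j D.slices [D.cut] else signSum i j D.slices [D.cut] / 2

/-- The number `σ₊` of positive eigenvalues of the linking matrix, with multiplicity. -/
def LinkDiagram.sigmaPos {ι : Type*} [Fintype ι] [DecidableEq ι] (D : LinkDiagram ι) : ℕ :=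
  letI := Classical.decPred fun x : ℝ => 0 < x
  (D.linkingMatrix.map (Int.cast : ℤ → ℝ)).charpoly.roots.countP fun x => 0 < x

/-! ## Boltzmann weights

The modules `U(t, N)₊` (upward strand) and `U(t, N)₋` (downward strand) have the basis `e₀`
(boson, `false`) and `e₁` (fermion, `true`). -/

/-- Weight of a minimum whose two ends are in the state `s`. -/
def cupWeight {B : Type*} [Field B] (c : Color B) (leftUp s : Bool) : B :=
  match leftUp, s with
  | true, false => 1
  | true, true => -(c.mul : B) ^ 2
  | false, false => (c.mul : B) ^ (-2 : ℤ)
  | false, true => 1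

/-- Weight of a maximum whose two ends are in the state `s`. -/
def capWeight {B : Type*} [Field B] (c : Color B) (leftUp s : Bool) : B :=
  match leftUp, s with
  | false, false => 1
  | false, true => -(c.mul : B) ^ (-2 : ℤ)
  | true, false => (c.mul : B) ^ 2
  | true, true => 1

/-- Weights of the crossing of two upward strands. The strand from bottom left to top right has
the color `(v, V)`, the other one has the color `(u, U)`. The states `a b` (bottom left, bottom
right) and `x y` (top left, top right) are listed in the order `a b x y`. -/
def upCrossWeight {B : Type*} [Field B] (lrOver : Bool) (cv cu : Color B) (a b x y : Bool) : B :=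
  let v : B := cv.mul
  let u : B := cu.mul
  let V : ℤ := cv.wt
  let U : ℤ := cu.wt
  match lrOver, a, b, x, y with
  | true, false, false, false, false => v ^ (1 - U) * u ^ (1 - V)
  | true, false, true, true, false => v ^ (-1 - U) * u ^ (1 - V)
  | true, true, false, false, true => v ^ (1 - U) * u ^ (-1 - V)
  | true, true, true, true, true => -(v ^ (-1 - U) * u ^ (-1 - V))
  | true, false, true, false, true => (v ^ 4 - 1) / (v ^ (1 + U) * u ^ (1 + V))
  | false, false, false, false, false => v ^ (U - 1) * u ^ (V - 1)
  | false, false, true, true, false => v ^ (U + 1) * u ^ (V - 1)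
  | false, true, false, false, true => v ^ (U - 1) * u ^ (V + 1)
  | false, true, true, true, true => -(v ^ (U + 1) * u ^ (V + 1))
  | false, true, false, true, false => (1 - u ^ 4) / (v ^ (1 - U) * u ^ (1 - V))
  | _, _, _, _, _ => 0

/-- Crossing with the left lower strand (color `l`) directed upward and the right lower strand
(color `r`) directed downward. It is obtained from a crossing of two upward strands by a rotation
through a quarter turn, that is, by composing it with a minimum and a maximum of the
downward strand: a minimum is inserted at the left, then the new upward strand crosses the
strand of color `l`, and then a maximum at the right is closed. -/
def upDownCrossWeight {B : Type*} [Field B] (lrOver : Bool) (l r : Color B) (a b x y : Bool) : B :=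
  cupWeight r false x * capWeight r true b * upCrossWeight (!lrOver) r l x a y b

/-- Crossing with the left lower strand (color `l`) directed downward and the right lower strand
(color `r`) directed upward, obtained by rotation: a minimum is inserted at the right, the strand
of color `r` crosses the new upward strand, and then a maximum at the left is closed. -/
def downUpCrossWeight {B : Type*} [Field B] (lrOver : Bool) (l r : Color B) (a b x y : Bool) : B :=
  cupWeight l true y * capWeight l false a * upCrossWeight (!lrOver) r l b y a x

/-- Crossing of two downward strands, obtained from `downUpCrossWeight` by a further
rotation. -/
def downDownCrossWeight {B : Type*} [Field B] (lrOver : Bool) (l r : Color B) (a b x y : Bool) : B :=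
  cupWeight l true y * capWeight l false a * downUpCrossWeight (!lrOver) r l b y a x

/-- Boltzmann weights of a crossing with arbitrary orientations; `l` and `r` are the colors of the
strands starting at the bottom left and at the bottom right. -/
def crossWeight {B : Type*} [Field B] (lrOver lUp rUp : Bool) (l r : Color B) (a b x y : Bool) : B :=
  match lUp, rUp with
  | true, true => upCrossWeight lrOver l r a b x y
  | true, false => upDownCrossWeight lrOver l r a b x y
  | false, true => downUpCrossWeight lrOver l r a b x y
  | false, false => downDownCrossWeight lrOver l r a b x y

/-! ## The Alexander polynomial of a colored framed link

A vector in the tensor product of `n` of the modules above is given by its coordinates: a function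
on lists of states, of which only those of length `n` matter. -/

/-- The morphism of a slice, applied to a vector `ψ`; `S` are the endpoints below the slice. -/
def Slice.apply {ι B : Type*} [Field B] (col : ι → Color B) (S : List (Strand ι)) :
    Slice ι → (List Bool → B) → (List Bool → B)
  | .cup p k up, ψ => fun l =>
    match l.drop p with
    | x :: y :: R => if x = y then cupWeight (col k) up x * ψ (l.take p ++ R) else 0
    | _ => 0
  | .cap p, ψ => fun l =>
    match S.drop p with
    | a :: _ :: _ => ∑ s : Bool, capWeight (col a.comp) a.up s * ψ (l.take p ++ s :: s :: l.drop p)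
    | _ => 0
  | .cross p lrOver, ψ => fun l =>
    match S.drop p, l.drop p with
    | a :: b :: _, x :: y :: R =>
      ∑ s : Bool, ∑ s' : Bool,
        crossWeight lrOver a.up b.up (col a.comp) (col b.comp) s s' x y *
          ψ (l.take p ++ s :: s' :: R)
    | _, _ => 0

/-- The composition of the morphisms of the slices, applied to a vector. -/
def applySlices {ι B : Type*} [Field B] (col : ι → Color B) :
    List (Slice ι) → List (Strand ι) → (List Bool → B) → (List Bool → B)
  | [], _, ψ => ψ
  | s :: w, S, ψ => applySlices col w (s.next S) (s.apply col S ψ)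

/-- The scalar by which the cut diagram acts on `U(t, N)`: the coefficient of `e₀` in the image
of `e₀`. -/
def LinkDiagram.scalar {ι B : Type*} [Field B] (D : LinkDiagram ι) (col : ι → Color B) : B :=
  applySlices col D.slices [D.cut] (fun l => if l = [false] then 1 else 0) [false]

/-- The Alexander polynomial `Δ` of a colored framed link: the scalar of the cut diagram, times the
inverse of `t² - t⁻²`, where `t` is the multiplicity of the component which was cut. -/
def LinkDiagram.alexander {ι B : Type*} [Field B] (D : LinkDiagram ι) (col : ι → Color B) : B :=
  D.scalar col * ((((col D.cut.comp).mul : B)) ^ 2 - ((col D.cut.comp).mul : B) ^ (-2 : ℤ))⁻¹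

/-- The Alexander polynomial of a framed link whose component `k` has the Kirby color
`Ω(t k, N k)`. It is the multilinear extension of
`Ω(t, N) = d(t) · (K colored by (t, N)) - d(t) · (-K colored by (t⁻¹, 2 - N))`. -/
def LinkDiagram.kirbyAlexander {ι B : Type*} [Fintype ι] [DecidableEq ι] [Field B]
    (D : LinkDiagram ι) (t : ι → Bˣ) (N : ι → ℤ) : B :=
  ∑ ε : ι → Bool, (∏ k, if ε k then -d (t k : B) else d (t k : B)) *
    (D.reverse ε).alexander fun k => if ε k then ⟨(t k)⁻¹, 2 - N k⟩ else ⟨t k, N k⟩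

/-- The 3-manifold invariant `Δ(M, ω) = Δ(L) / (2 ^ r(L) * (-1) ^ σ₊(L))`, computed from
the diagram of a surgery presentation `L`, where each component `K` has Kirby color `Ω(t, 1)` with
`t = ω([m_K])`. -/
def LinkDiagram.invariant {ι B : Type*} [Fintype ι] [DecidableEq ι] [Field B]
    (D : LinkDiagram ι) (t : ι → Bˣ) : B :=
  D.kirbyAlexander t (fun _ => 1) / (2 ^ Fintype.card ι * (-1) ^ D.sigmaPos)

/-! ## The diagram of the presentation -/

/-- A curl on the upward strand of component `k` at position `p`; its crossing has the sign given
by `positive`, so that it adds a positive or a negative full twist to the framing. -/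
def curl (p : ℕ) (k : Fin 2) (positive : Bool) : List (Slice (Fin 2)) :=
  [.cup (p + 1) k true, .cross p positive, .cap (p + 1)]

/-- `m` full twists on the upward strand of component `k` at position `p`. -/
def twists (p : ℕ) (k : Fin 2) (m : ℤ) : List (Slice (Fin 2)) :=
  (List.replicate m.natAbs (curl p k (decide (0 < m)))).flatten

/-- The slices of the Hopf link diagram, from the bottom to the top. -/
def hopfSlices (m n : ℤ) : List (Slice (Fin 2)) :=
  twists 0 1 n ++ (.cup 0 0 false :: (twists 1 0 m ++
    [.cross 1 false, .cross 1 false, .cap 0]))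

theorem joins_twists_zero (n : ℤ) (w : List (Slice (Fin 2))) (T : List (Strand (Fin 2)))
    (h : Joins w [⟨1, true⟩] T) : Joins (twists 0 1 n ++ w) [⟨1, true⟩] T := by
  unfold twists
  generalize n.natAbs = k
  induction k with
  | zero => simpa using h
  | succ k ih =>
    simp only [List.replicate_succ, List.flatten_cons, List.append_assoc]
    refine ⟨by simp [Slice.Fits], by simp [Slice.Fits, Slice.next], ?_, ?_⟩
    · exact ⟨_, _, _, rfl, rfl, rfl⟩
    · exact ih

theorem joins_twists_one (m : ℤ) (w : List (Slice (Fin 2))) (T : List (Strand (Fin 2)))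
    (h : Joins w [⟨0, false⟩, ⟨0, true⟩, ⟨1, true⟩] T) :
    Joins (twists 1 0 m ++ w) [⟨0, false⟩, ⟨0, true⟩, ⟨1, true⟩] T := by
  unfold twists
  generalize m.natAbs = k
  induction k with
  | zero => simpa using h
  | succ k ih =>
    simp only [List.replicate_succ, List.flatten_cons, List.append_assoc]
    refine ⟨by simp [Slice.Fits], by simp [Slice.Fits, Slice.next], ?_, ?_⟩
    · exact ⟨_, _, _, rfl, rfl, rfl⟩
    · exact ih

/-- The diagram of the Hopf link with linking number `-1` and framings `m` and `n`: the closed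
component `0` on the left has `m` full twists, the component `1` on the right, which is cut open,
has `n` full twists. In between there are two negative crossings. -/
def hopfDiagram (m n : ℤ) : LinkDiagram (Fin 2) where
  cut := ⟨1, true⟩
  slices := hopfSlices m n
  joins := by
    refine joins_twists_zero n _ _ ⟨by simp [Slice.Fits], ?_⟩
    refine joins_twists_one m _ _ ?_
    exact ⟨by simp [Slice.Fits], by simp [Slice.Fits, Slice.next], ⟨_, _, _, rfl, rfl, rfl⟩, rfl⟩

/-! ## Framed links in the 3-sphere, surgery, lens spaces -/

/-- The unit sphere in `ℂ²`. -/
abbrev Sphere3 : Type := {p : ℂ × ℂ // ‖p.1‖ ^ 2 + ‖p.2‖ ^ 2 = 1}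

/-- The closed unit disk. -/
abbrev Disk : Type := {z : ℂ // ‖z‖ ≤ 1}

/-- A point of the circle as a boundary point of the disk. -/
def circleToDisk (x : Circle) : Disk := ⟨x, (Circle.norm_coe x).le⟩

/-- A framed oriented link in the 3-sphere, given by disjoint parametrized closed tubular
neighborhoods `S¹ × D²` of its components. The cores `S¹ × {0}` are the oriented components,
the curves `S¹ × {1}` are their parallels given by the framing. -/
structure FramedLink (ι : Type*) where
  nbhd : ι → Circle → Disk → Sphere3
  continuous_nbhd : ∀ i, Continuous fun q : Circle × Disk => nbhd i q.1 q.2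
  injective_nbhd : Function.Injective fun q : ι × Circle × Disk => nbhd q.1 q.2.1 q.2.2

/-- The exterior of a framed link: the complement of the open tubular neighborhoods. -/
abbrev FramedLink.Exterior {ι : Type*} (L : FramedLink ι) : Type :=
  {p : Sphere3 // ∀ i x z, L.nbhd i x z = p → ‖(z : ℂ)‖ = 1}

/-- The identification of the boundary of the glued solid tori `D² × S¹` with the boundary of
the exterior: the boundary of the disk `D² × {y}` is glued to the parallel of the core
through `y`. -/
def FramedLink.surgeryRel {ι : Type*} (L : FramedLink ι) :
    L.Exterior ⊕ (Σ _ : ι, Disk × Circle) → L.Exterior ⊕ (Σ _ : ι, Disk × Circle) → Prop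
  | .inl p, .inr ⟨i, z, y⟩ =>
    ∃ x : Circle, z = circleToDisk x ∧ p.1 = L.nbhd i x (circleToDisk y)
  | _, _ => False

/-- The manifold obtained from the 3-sphere by integral surgery along a framed link. -/
def FramedLink.Surgery {ι : Type*} (L : FramedLink ι) : Type _ := Quot L.surgeryRel

instance {ι : Type*} (L : FramedLink ι) : TopologicalSpace L.Surgery :=
  inferInstanceAs (TopologicalSpace (Quot L.surgeryRel))

/-- The oriented meridian of the component `i`, as a loop in the surgered manifold. -/
def FramedLink.meridian {ι : Type*} (L : FramedLink ι) (i : ι) : C(Circle, L.Surgery) where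
  toFun y := Quot.mk _ (.inl ⟨L.nbhd i 1 (circleToDisk y), by
    intro j x z h
    have h' := L.injective_nbhd (a₁ := (j, x, z)) (a₂ := (i, 1, circleToDisk y)) h
    simp only [Prod.mk.injEq] at h'
    rw [h'.2.2]
    exact Circle.norm_coe y⟩)
  continuous_toFun := by
    refine continuous_quot_mk.comp (continuous_inl.comp (Continuous.subtype_mk ?_ _))
    refine (L.continuous_nbhd i).comp (continuous_const.prodMk ?_)
    exact Continuous.subtype_mk continuous_subtype_val _

/-- The radius of the core direction in the tubular neighborhoods of the Hopf link. -/
def coreRadius (z : Disk) : ℝ := Real.sqrt (1 - ‖(z : ℂ)‖ ^ 2 / 4)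

theorem coreRadius_sq (z : Disk) : coreRadius z ^ 2 = 1 - ‖(z : ℂ)‖ ^ 2 / 4 := by
  have h := z.2
  exact Real.sq_sqrt (by nlinarith [norm_nonneg (z : ℂ)])

theorem coreRadius_pos (z : Disk) : 0 < coreRadius z := by
  have h := z.2
  exact Real.sqrt_pos.2 (by nlinarith [norm_nonneg (z : ℂ)])

/-- The tubular neighborhoods of the two components of the Hopf link. The component `0` is the
circle `{w = 0}` with the orientation of the unit circle of `ℂ`, the component `1` is the circle
`{z = 0}` with the opposite orientation, so that their linking number is `-1`. Both
parametrizations preserve the orientation, and the framings are `m` and `n`. -/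
def hopfNbhd (m n : ℤ) (i : Fin 2) (x : Circle) (z : Disk) : ℂ × ℂ :=
  if i = 0 then ((coreRadius z : ℂ) * x, ((x ^ m : Circle) : ℂ) * z / 2)
  else (((x ^ (-n) : Circle) : ℂ) * starRingEnd ℂ z / 2, (coreRadius z : ℂ) * (x⁻¹ : Circle))

theorem hopfNbhd_mem (m n : ℤ) (i : Fin 2) (x : Circle) (z : Disk) :
    ‖(hopfNbhd m n i x z).1‖ ^ 2 + ‖(hopfNbhd m n i x z).2‖ ^ 2 = 1 := by
  have h := coreRadius_sq z
  unfold hopfNbhd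
  split_ifs
  · simp only [norm_mul, norm_div, Circle.norm_coe, Complex.norm_real, Real.norm_eq_abs,
      Complex.norm_ofNat, mul_one, one_mul, sq_abs, div_pow, h]
    ring
  · simp only [norm_mul, norm_div, Circle.norm_coe, Complex.norm_real, Real.norm_eq_abs,
      Complex.norm_ofNat, mul_one, one_mul, sq_abs, div_pow, h, RCLike.norm_conj]
    ring

theorem hopfNbhd_continuous (m n : ℤ) (i : Fin 2) :
    Continuous fun q : Circle × Disk => hopfNbhd m n i q.1 q.2 := by
  have hc : Continuous coreRadius := by unfold coreRadius; fun_prop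
  have hcoe : Continuous fun x : Circle => (x : ℂ) := continuous_subtype_val
  have h1 : ∀ k : ℤ, Continuous fun q : Circle × Disk => ((q.1 ^ k : Circle) : ℂ) := fun k =>
    hcoe.comp ((continuous_zpow k).comp continuous_fst)
  have h2 : Continuous fun q : Circle × Disk => ((q.1⁻¹ : Circle) : ℂ) :=
    hcoe.comp (continuous_inv.comp continuous_fst)
  have h3 : Continuous fun q : Circle × Disk => (q.1 : ℂ) :=
    continuous_subtype_val.comp continuous_fst
  have h4 : Continuous fun q : Circle × Disk => (q.2 : ℂ) :=
    continuous_subtype_val.comp continuous_snd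
  have h5 : Continuous fun q : Circle × Disk => (coreRadius q.2 : ℂ) :=
    Complex.continuous_ofReal.comp (hc.comp continuous_snd)
  have h6 : Continuous fun q : Circle × Disk => starRingEnd ℂ (q.2 : ℂ) :=
    Complex.continuous_conj.comp h4
  unfold hopfNbhd
  split_ifs
  · exact (h5.mul h3).prodMk (((h1 m).mul h4).div_const 2)
  · exact (((h1 (-n)).mul h6).div_const 2).prodMk (h5.mul h2)

/-- A positive multiple of a point of the circle determines the point. -/
theorem circle_eq_of_mul_eq {a b : ℝ} (ha : 0 < a) (hb : 0 < b) {x y : Circle}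
    (h : (a : ℂ) * x = b * y) : x = y := by
  have h1 := congrArg norm h
  simp only [norm_mul, Circle.norm_coe, Complex.norm_real, Real.norm_eq_abs, mul_one,
    abs_of_pos ha, abs_of_pos hb] at h1
  subst h1
  have h2 : (a : ℂ) ≠ 0 := by exact_mod_cast ha.ne'
  exact Subtype.ext (mul_left_cancel₀ h2 h)

theorem hopfNbhd_zero_ne_one (m n : ℤ) (x x' : Circle) (z z' : Disk) :
    hopfNbhd m n 0 x z ≠ hopfNbhd m n 1 x' z' := by
  intro h
  have h1 := congrArg (fun p : ℂ × ℂ => ‖p.1‖ ^ 2) h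
  have hz := z.2
  have hz' := z'.2
  have hs := coreRadius_sq z
  simp only [hopfNbhd, if_true, one_ne_zero, if_false, norm_mul, norm_div, Circle.norm_coe,
    Complex.norm_real, Real.norm_eq_abs, Complex.norm_ofNat, mul_one, one_mul, sq_abs, div_pow, hs,
    RCLike.norm_conj] at h1
  nlinarith [norm_nonneg (z : ℂ), norm_nonneg (z' : ℂ)]

theorem hopfNbhd_injective (m n : ℤ) :
    Function.Injective fun q : Fin 2 × Circle × Disk => hopfNbhd m n q.1 q.2.1 q.2.2 := by
  rintro ⟨i, x, z⟩ ⟨j, x', z'⟩ h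
  have h' : hopfNbhd m n i x z = hopfNbhd m n j x' z' := h
  have h2 : (2 : ℂ) ≠ 0 := two_ne_zero
  fin_cases i <;> fin_cases j
  · have e1 : (coreRadius z : ℂ) * x = coreRadius z' * x' := congrArg Prod.fst h'
    have hx := circle_eq_of_mul_eq (coreRadius_pos z) (coreRadius_pos z') e1
    subst hx
    have e2 : ((x ^ m : Circle) : ℂ) * z / 2 = ((x ^ m : Circle) : ℂ) * z' / 2 :=
      congrArg Prod.snd h'
    have hz : z = z' := Subtype.ext
      (mul_left_cancel₀ (Circle.coe_ne_zero _) ((div_left_inj' h2).1 e2))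
    rw [hz]
  · exact absurd h' (hopfNbhd_zero_ne_one m n x x' z z')
  · exact absurd h'.symm (hopfNbhd_zero_ne_one m n x' x z' z)
  · have e1 : (coreRadius z : ℂ) * (x⁻¹ : Circle) = coreRadius z' * (x'⁻¹ : Circle) :=
      congrArg Prod.snd h'
    have hx := inv_injective (circle_eq_of_mul_eq (coreRadius_pos z) (coreRadius_pos z') e1)
    subst hx
    have e2 : ((x ^ (-n) : Circle) : ℂ) * starRingEnd ℂ z / 2 =
        ((x ^ (-n) : Circle) : ℂ) * starRingEnd ℂ z' / 2 := congrArg Prod.fst h'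
    have hz : z = z' := Subtype.ext ((starRingEnd ℂ).injective
      (mul_left_cancel₀ (Circle.coe_ne_zero _) ((div_left_inj' h2).1 e2)))
    rw [hz]

/-- The Hopf link with linking number `-1` and framings `m` and `n`. -/
def hopfLink (m n : ℤ) : FramedLink (Fin 2) where
  nbhd i x z := ⟨hopfNbhd m n i x z, hopfNbhd_mem m n i x z⟩
  continuous_nbhd i := Continuous.subtype_mk (hopfNbhd_continuous m n i) _
  injective_nbhd := fun _ _ h => hopfNbhd_injective m n (congrArg Subtype.val h)

/-- Two solid tori `D² × S¹`, where the boundary point `(x, y)` of the second one is glued to the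
boundary point `(x ^ q * y ^ s, x ^ p * y ^ r)` of the first one. The meridian of the second solid
torus is glued to a curve which runs `q` times along the meridian and `p` times along the
core of the first one. -/
def lensRel (p q r s : ℤ) : (Disk × Circle) ⊕ (Disk × Circle) →
    (Disk × Circle) ⊕ (Disk × Circle) → Prop
  | .inl a, .inr b => ∃ x : Circle, b.1 = circleToDisk x ∧
      a = (circleToDisk (x ^ q * b.2 ^ s), x ^ p * b.2 ^ r)
  | _, _ => False

/-- `X` is homeomorphic to the lens space `L(p, q)`: the union of two solid tori glued
along their boundaries by a homeomorphism which maps the meridian of the second one to the curve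
`q • meridian + p • core` of the first one. Any integers `p`, `q` which are coprime are
allowed; for example `L(0, 1) = S² × S¹` and `L(1, q) = S³`. -/
def IsLensSpace (X : Type*) [TopologicalSpace X] (p q : ℤ) : Prop :=
  ∃ r s : ℤ, q * r - p * s = 1 ∧ Nonempty (X ≃ₜ Quot (lensRel p q r s))

/-! ## First homology -/

/-- The first integral homology group of a path connected space, written multiplicatively: the
abelianization of the fundamental group. -/
abbrev H1 (X : Type*) [TopologicalSpace X] (x₀ : X) : Type _ :=
  Abelianization (FundamentalGroup X x₀)

/-- A map from the circle as a path. -/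
def loopPath {X : Type*} [TopologicalSpace X] (γ : C(Circle, X)) : Path (γ 1) (γ 1) where
  toFun t := γ (Circle.exp (2 * Real.pi * t))
  source' := by simp
  target' := by simp

open Classical in
/-- The homology class of a free loop `γ`: it is connected with the base point by any path. (The
default value `1` does not occur if the space is path connected.) -/
def loopClass {X : Type*} [TopologicalSpace X] (x₀ : X) (γ : C(Circle, X)) : H1 X x₀ :=
  if h : Joined x₀ (γ 1) then
    Abelianization.of (FundamentalGroup.fromPath (Path.Homotopic.Quotient.mk
      ((h.somePath.trans (loopPath γ)).trans h.somePath.symm)))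
  else 1

end GlAlexander

end

/-!
The exterior of the Hopf link is a thickened torus: `{|z| ≥ 1/2, |w| ≥ 1/2}` in the unit sphere of
`ℂ²`, foliated by tori `|w| = const` with coordinates the arguments of `z` and `w`. Everything on the
topological side is read off from these coordinates.

*The lens space.* The solid torus of component `0` together with the exterior is again a solid
torus, of which the exterior is a collar. This gives a continuous surjection of the disjoint union
of the exterior and the two glued solid tori onto the disjoint union of two solid tori. It is a
quotient map by compactness, and it turns the surgery relation into the gluing relation of the lens
space `L(mn - 1, n)` (`isLensSpace_hopfLink_surgery`).

*The first homology.* On a level torus the parallel of component `0` is the curve `(x, x ^ m)`,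
the meridians of the components `0` and `1` are `(1, x)` and `(x⁻¹, 1)`. Classes of loops on a torus are
multiplicative (`loopClass_comp_mul`) and the parallel bounds a disk in the glued solid torus, so
`m • [m₁] = [m₂]`, and likewise `n • [m₂] = [m₁]` (`meridian_zero_zpow`, `meridian_one_zpow`). So
`u ^ m = v` and `v ^ n = u`.

*The state sum.* For weight `1`, a full twist on a strand of multiplicity `t` acts as `t ^ (∓2)`
(`applySlices_twists`), and the untwisted Hopf link with multiplicities `p`, `q` has the Alexander
polynomial `-p²q²` or `p⁻²q⁻²`, according to whether an even or an odd number of the components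
is reversed (`hopfDiagram_alexander`). By the two relations in homology the
framing factors cancel these monomials, so that each of the four terms in the expansion of the Kirby
colors is `-d(u)d(v)` (`kirby_term`). The denominator `q² - q⁻²` does not vanish since `v ≠ 1` and `G`
has no other solution of `t ^ 4 = 1`.
-/

noncomputable section

namespace GlAlexander

/-! ### The state sum of the Hopf link diagram -/

/-- A curl on a strand of weight `1` and multiplicity `t` is the scalar `t ^ (∓2)`, whatever the
direction of the strand: the coefficients of `e_a ↦ e_x`, the state `s` of the closed part of the
curl being summed over. -/
theorem curl_weight {B : Type*} [Field B] (c : Color B) (hc : c.wt = 1) (up pos a x : Bool) :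
    ∑ s : Bool, capWeight c up s * (crossWeight pos up up c c a s x s * cupWeight c up s) =
      if a = x then (c.mul : B) ^ (if pos then -2 else 2 : ℤ) else 0 := by
  have ht : (c.mul : B) ≠ 0 := Units.ne_zero _
  cases up <;> cases pos <;> cases a <;> cases x <;>
    simp [crossWeight, cupWeight, capWeight, upCrossWeight, downDownCrossWeight,
      downUpCrossWeight, hc] <;>
    field_simp <;> ring_nf

theorem take_length_succ_append {α : Type*} (A R : List α) (x : α) :
    (A ++ x :: R).take (A.length + 1) = A ++ [x] := by
  simp [List.take_append]

theorem drop_length_succ_append {α : Type*} (A R : List α) (x : α) :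
    (A ++ x :: R).drop (A.length + 1) = R := by
  simp [List.drop_append]

theorem drop_length_add_three_append {α : Type*} (A R : List α) (x y z : α) :
    (A ++ x :: y :: z :: R).drop (A.length + 1 + 2) = R := by
  rw [show A ++ x :: y :: z :: R = (A ++ [x, y, z]) ++ R by simp]
  exact List.drop_left' (by simp)

theorem next_cup_curl {ι : Type*} (P Q : List (Strand ι)) (k : ι) (up : Bool) :
    (Slice.cup (P.length + 1) k up).next (P ++ ⟨k, up⟩ :: Q) =
      P ++ ⟨k, up⟩ :: ⟨k, up⟩ :: ⟨k, !up⟩ :: Q := by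
  simp [Slice.next, take_length_succ_append, drop_length_succ_append]

theorem next_cross_curl {ι : Type*} (P Q : List (Strand ι)) (k : ι) (up pos : Bool) :
    (Slice.cross P.length pos).next (P ++ ⟨k, up⟩ :: ⟨k, up⟩ :: ⟨k, !up⟩ :: Q) =
      P ++ ⟨k, up⟩ :: ⟨k, up⟩ :: ⟨k, !up⟩ :: Q := by
  simp [Slice.next]

theorem next_cap_curl {ι : Type*} (P Q : List (Strand ι)) (k : ι) (up : Bool) :
    (Slice.cap (P.length + 1)).next (P ++ ⟨k, up⟩ :: ⟨k, up⟩ :: ⟨k, !up⟩ :: Q) =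
      P ++ ⟨k, up⟩ :: Q := by
  simp only [Slice.next, take_length_succ_append, drop_length_add_three_append]
  simp

/-- The morphism of a slice preserves the property of being supported on the lists of states whose
length is the number of endpoints. A vector is a function on lists of all lengths, so equations
between vectors need this control of the irrelevant coordinates. -/
theorem apply_eq_zero_of_length_ne {ι B : Type*} [Field B] (col : ι → Color B)
    {S : List (Strand ι)} {s : Slice ι} (hs : s.Fits S) {ψ : List Bool → B}
    (hψ : ∀ l, l.length ≠ S.length → ψ l = 0) (l : List Bool) (hl : l.length ≠ (s.next S).length) :
    s.apply col S ψ l = 0 := by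
  cases s with
  | cup p k up =>
    simp only [Slice.Fits] at hs
    have hS : (Slice.next (.cup p k up) S).length = S.length + 2 := by
      simp [Slice.next]; omega
    rw [hS] at hl
    simp only [Slice.apply]
    split
    · next x y R h =>
      have h2 := congrArg List.length h
      simp only [List.length_drop, List.length_cons] at h2
      rw [hψ, mul_zero, ite_self]
      simp only [List.length_append, List.length_take]
      omega
    · rfl
  | cap p =>
    obtain ⟨a, b, R, h, -, -⟩ := hs
    have h2 := congrArg List.length h
    simp only [List.length_drop, List.length_cons] at h2
    have hS : (Slice.next (.cap p) S).length = S.length - 2 := by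
      simp [Slice.next]; omega
    rw [hS] at hl
    simp only [Slice.apply, h]
    refine Finset.sum_eq_zero fun s _ => ?_
    rw [hψ, mul_zero]
    simp only [List.length_append, List.length_take, List.length_cons, List.length_drop]
    omega
  | cross p o =>
    simp only [Slice.Fits] at hs
    simp only [Slice.next, Slice.apply] at hl ⊢
    split
    · next a b R x y R' h h' =>
      have h2 := congrArg List.length h
      have h3 := congrArg List.length h'
      simp only [List.length_cons, List.length_drop] at h2 h3
      simp only [h, List.length_append, List.length_take, List.length_cons] at hl
      refine Finset.sum_eq_zero fun s _ => Finset.sum_eq_zero fun s' _ => ?_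
      rw [hψ, mul_zero]
      simp only [List.length_append, List.length_take, List.length_cons]
      omega
    · rfl

/-- A curl inserted into the strand at position `P.length` multiplies the vector by a scalar. -/
theorem applySlices_curl {ι B : Type*} [Field B] (col : ι → Color B) (P Q : List (Strand ι)) (k : ι)
    (hk : (col k).wt = 1) (up pos : Bool) (ψ : List Bool → B)
    (hψ : ∀ l, l.length ≠ (P ++ ⟨k, up⟩ :: Q).length → ψ l = 0) (w : List (Slice ι)) :
    applySlices col (.cup (P.length + 1) k up :: .cross P.length pos :: .cap (P.length + 1) :: w)
        (P ++ ⟨k, up⟩ :: Q) ψ =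
      applySlices col w (P ++ ⟨k, up⟩ :: Q)
        (((col k).mul : B) ^ (if pos then -2 else 2 : ℤ) • ψ) := by
  have e1 := next_cup_curl P Q k up
  have e2 := next_cross_curl P Q k up pos
  have e3 := next_cap_curl P Q k up
  have f1 : (Slice.cup (P.length + 1) k up).Fits (P ++ ⟨k, up⟩ :: Q) := by
    simp only [Slice.Fits, List.length_append, List.length_cons]; omega
  have f2 : (Slice.cross P.length pos).Fits (P ++ ⟨k, up⟩ :: ⟨k, up⟩ :: ⟨k, !up⟩ :: Q) := by
    simp only [Slice.Fits, List.length_append, List.length_cons]; omega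
  have f3 : (Slice.cap (P.length + 1)).Fits (P ++ ⟨k, up⟩ :: ⟨k, up⟩ :: ⟨k, !up⟩ :: Q) :=
    ⟨⟨k, up⟩, ⟨k, !up⟩, Q, drop_length_succ_append _ _ _, rfl, rfl⟩
  simp only [applySlices, e1, e2, e3]
  congr 1
  funext l
  by_cases hl : l.length = (P ++ ⟨k, up⟩ :: Q).length
  · simp only [List.length_append, List.length_cons] at hl
    obtain ⟨A, x, R, hA, rfl⟩ : ∃ A x R, A.length = P.length ∧ l = A ++ x :: R := by
      refine ⟨l.take P.length, l[P.length], l.drop (P.length + 1), by simp; omega, ?_⟩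
      simp
    have h0 := curl_weight (col k) hk up pos x x
    have h1 := curl_weight (col k) hk up pos (!x) x
    have step (s : Bool) : A ++ [x] ++ s :: s :: R = A ++ x :: s :: s :: R := by simp
    have e4 : List.drop A.length (P ++ ⟨k, up⟩ :: ⟨k, up⟩ :: ⟨k, !up⟩ :: Q) =
        ⟨k, up⟩ :: ⟨k, up⟩ :: ⟨k, !up⟩ :: Q := by simp [hA]
    have e5 : List.drop (A.length + 1) (P ++ ⟨k, up⟩ :: ⟨k, up⟩ :: ⟨k, !up⟩ :: Q) =
        ⟨k, up⟩ :: ⟨k, !up⟩ :: Q := hA ▸ drop_length_succ_append _ _ _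
    simp only [Slice.apply, ← hA, e4, e5, drop_length_succ_append, List.drop_left,
      take_length_succ_append, List.take_left, step, Fintype.sum_bool, List.append_assoc,
      List.singleton_append, Pi.smul_apply, smul_eq_mul] at h0 h1 ⊢
    generalize capWeight (col k) up = cap at *
    generalize cupWeight (col k) up = cup at *
    generalize crossWeight pos up up (col k) (col k) = cr at *
    generalize ((col k).mul : B) ^ (if pos then -2 else 2 : ℤ) = t at *
    cases x
    · simp at h0 h1 ⊢
      linear_combination h0 * ψ (A ++ false :: R) + h1 * ψ (A ++ true :: R)
    · simp at h0 h1 ⊢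
      linear_combination h0 * ψ (A ++ true :: R) + h1 * ψ (A ++ false :: R)
  · rw [Pi.smul_apply, hψ l hl, smul_zero]
    have g1 := apply_eq_zero_of_length_ne col f1 hψ
    rw [e1] at g1
    have g2 := apply_eq_zero_of_length_ne col f2 g1
    rw [e2] at g2
    have g3 := apply_eq_zero_of_length_ne col f3 g2
    rw [e3] at g3
    exact g3 l hl

/-- `m` full twists act as `t ^ (-2 * m)`, for every choice of orientations. -/
theorem applySlices_twists {B : Type*} [Field B] (col : Fin 2 → Color B)
    (P Q : List (Strand (Fin 2))) (k : Fin 2) (hk : (col k).wt = 1) (ε : Fin 2 → Bool) (m : ℤ)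
    (ψ : List Bool → B)
    (hψ : ∀ l, l.length ≠ (P ++ Strand.reverse ε ⟨k, true⟩ :: Q).length → ψ l = 0)
    (w : List (Slice (Fin 2))) :
    applySlices col ((twists P.length k m).map (Slice.reverse ε) ++ w)
        (P ++ Strand.reverse ε ⟨k, true⟩ :: Q) ψ =
      applySlices col w (P ++ Strand.reverse ε ⟨k, true⟩ :: Q)
        (((col k).mul : B) ^ (-2 * m) • ψ) := by
  -- The vector is generalized, since each curl rescales it.
  have key (j : ℕ) : ∀ ψ : List Bool → B,
      (∀ l, l.length ≠ (P ++ Strand.reverse ε ⟨k, true⟩ :: Q).length → ψ l = 0) →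
      applySlices col
        (((List.replicate j (curl P.length k (decide (0 < m)))).flatten).map (Slice.reverse ε) ++ w)
        (P ++ Strand.reverse ε ⟨k, true⟩ :: Q) ψ =
      applySlices col w (P ++ Strand.reverse ε ⟨k, true⟩ :: Q)
        ((((col k).mul : B) ^ (if decide (0 < m) then -2 else 2 : ℤ)) ^ j • ψ) := by
    induction j with
    | zero => intro ψ hψ; simp
    | succ j ih =>
      intro ψ hψ
      rw [List.replicate_succ, List.flatten_cons, List.map_append, List.append_assoc, pow_succ,
        mul_smul]
      refine (applySlices_curl col P Q k hk _ _ ψ hψ _).trans (ih _ fun l hl => ?_)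
      rw [Pi.smul_apply, hψ l hl, smul_zero]
  rw [twists, key _ ψ hψ, ← zpow_natCast, ← zpow_mul]
  congr 3
  by_cases hm : 0 < m
  · rw [if_pos (decide_eq_true hm), Int.natCast_natAbs, abs_of_pos hm]
  · rw [if_neg (by simpa using hm), Int.natCast_natAbs, abs_of_nonpos (not_lt.1 hm)]
    ring

/-- The top of the Hopf link diagram, which consists of the two crossings between the components and
the maximum of component `0`, applied to `K` times the minimum of component `0`. Only parallel or
antiparallel orientation of the components matters. -/
theorem applySlices_clasp {B : Type*} [Field B] (col : Fin 2 → Color B) (h0 : (col 0).wt = 1)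
    (h1 : (col 1).wt = 1) (ε : Fin 2 → Bool) (ψ : List Bool → B) (K : B)
    (hb : ψ [false, false, false] = K * cupWeight (col 0) (xor false (ε 0)) false)
    (hf : ψ [true, true, false] = K * cupWeight (col 0) (xor false (ε 0)) true)
    (h2 : ψ [false, true, true] = 0)
    (h3 : ψ [true, false, true] = 0) :
    applySlices col
        (([.cross 1 false, .cross 1 false, .cap 0] : List (Slice (Fin 2))).map (Slice.reverse ε))
        ([⟨0, false⟩, ⟨0, true⟩, ⟨1, true⟩].map (Strand.reverse ε)) ψ [false] =
      K * if ε 0 = ε 1 then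
          ((col 0).mul : B) ^ 2 * (1 - ((col 1).mul : B) ^ 4)
        else ((col 0).mul : B) ^ (-2 : ℤ) * (1 - ((col 1).mul : B) ^ (-4 : ℤ)) := by
  have ht : ((col 0).mul : B) ≠ 0 := Units.ne_zero _
  have ht' : ((col 1).mul : B) ≠ 0 := Units.ne_zero _
  simp [applySlices, Slice.apply, Slice.reverse, Slice.next, Strand.reverse, hb, hf, h2, h3]
  cases ε 0 <;> cases ε 1 <;>
    simp [crossWeight, cupWeight, capWeight, upCrossWeight, upDownCrossWeight,
      downDownCrossWeight, downUpCrossWeight, h0, h1] <;>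
    field_simp <;> ring_nf

/-- The scalar of the Hopf link diagram with components of weight `1`, reoriented by `ε`. -/
theorem hopfDiagram_scalar {B : Type*} [Field B] (m n : ℤ) (col : Fin 2 → Color B)
    (h0 : (col 0).wt = 1) (h1 : (col 1).wt = 1) (ε : Fin 2 → Bool) :
    ((hopfDiagram m n).reverse ε).scalar col =
      ((col 0).mul : B) ^ (-2 * m) * ((col 1).mul : B) ^ (-2 * n) * if ε 0 = ε 1 then
          ((col 0).mul : B) ^ 2 * (1 - ((col 1).mul : B) ^ 4)
        else ((col 0).mul : B) ^ (-2 : ℤ) * (1 - ((col 1).mul : B) ^ (-4 : ℤ)) := by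
  unfold LinkDiagram.scalar LinkDiagram.reverse hopfDiagram hopfSlices
  simp only [List.map_append, List.map_cons]
  have e1 := applySlices_twists col [] [] 1 h1 ε n (fun l => if l = [false] then 1 else 0)
  simp only [List.nil_append, List.length_nil] at e1
  rw [e1]
  swap
  · intro l hl
    rw [if_neg]
    rintro rfl
    exact hl rfl
  simp only [applySlices]
  set ψ := Slice.apply col [Strand.reverse ε ⟨1, true⟩] (Slice.reverse ε (.cup 0 0 false))
      (((col 1).mul : B) ^ (-2 * n) • fun l => if l = [false] then 1 else 0) with hψ
  have e2 := applySlices_twists col [Strand.reverse ε ⟨0, false⟩] [Strand.reverse ε ⟨1, true⟩] 0 h0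
    ε m ψ
  have e3 : (Slice.reverse ε (.cup 0 0 false)).next [Strand.reverse ε ⟨1, true⟩] =
     [Strand.reverse ε ⟨0, false⟩] ++ Strand.reverse ε ⟨0, true⟩ :: [Strand.reverse ε ⟨1, true⟩] := by
    simp [Slice.reverse, Slice.next, Strand.reverse]
  rw [e3]
  refine (congrFun (e2 ?_ _) _).trans ?_
  · rw [← e3]
    refine apply_eq_zero_of_length_ne col (by simp [Slice.reverse, Slice.Fits]) fun l hl => ?_
    rw [Pi.smul_apply, if_neg, smul_zero]
    rintro rfl
    exact hl rfl
  · refine applySlices_clasp col h0 h1 ε _ _ ?_ ?_ ?_ ?_ <;>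
      simp [hψ, Slice.apply, Slice.reverse] <;> ring

/-- Dividing the scalar by `q² - q⁻²`, where `q` is the multiplicity of the cut component, leaves a
monomial. -/
theorem hopfDiagram_alexander {B : Type*} [Field B] (m n : ℤ) (col : Fin 2 → Color B)
    (h0 : (col 0).wt = 1) (h1 : (col 1).wt = 1) (hq : ((col 1).mul : B) ^ 4 ≠ 1)
    (ε : Fin 2 → Bool) :
    ((hopfDiagram m n).reverse ε).alexander col =
      ((col 0).mul : B) ^ (-2 * m) * ((col 1).mul : B) ^ (-2 * n) * if ε 0 = ε 1 then
          -(((col 0).mul : B) ^ 2 * ((col 1).mul : B) ^ 2)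
        else (((col 0).mul : B) ^ 2 * ((col 1).mul : B) ^ 2)⁻¹ := by
  have hp : ((col 0).mul : B) ≠ 0 := Units.ne_zero _
  have hq0 : ((col 1).mul : B) ≠ 0 := Units.ne_zero _
  have hd : ((col 1).mul : B) ^ 2 - ((col 1).mul : B) ^ (-2 : ℤ) ≠ 0 := by
    intro h
    field_simp at h
    exact hq (by linear_combination h)
  have hc : ((hopfDiagram m n).reverse ε).cut.comp = 1 := rfl
  rw [LinkDiagram.alexander, hopfDiagram_scalar _ _ _ h0 h1, hc, mul_assoc]
  congr 1
  rw [← div_eq_mul_inv, div_eq_iff hd]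
  split_ifs
  · field_simp
    ring
  · field_simp

/-- With `u ^ m = v` and `v ^ n = u` the framing factors `u ^ (∓2m)`, `v ^ (∓2n)` cancel the
monomials `u ^ (±2)`, `v ^ (±2)` of the Hopf link. Hence all terms of the expansion of the Kirby
colors are equal. -/
theorem kirby_term {B : Type*} [Field B] (m n : ℤ) (u v : Bˣ) (huv : u ^ m = v)
    (hvu : v ^ n = u) (hv : v ^ 4 ≠ 1) (ε : Fin 2 → Bool) :
    (∏ k, if ε k then -d ((![u, v] k : Bˣ) : B) else d ((![u, v] k : Bˣ) : B)) *
      ((hopfDiagram m n).reverse ε).alexander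
        (fun k => if ε k then ⟨(![u, v] k)⁻¹, 2 - 1⟩ else ⟨![u, v] k, 1⟩) =
      -(d (u : B) * d (v : B)) := by
  have hu0 : (u : B) ≠ 0 := u.ne_zero
  have hv0 : (v : B) ≠ 0 := v.ne_zero
  have huv' : (u : B) ^ m = v := by rw [← Units.val_zpow_eq_zpow_val, huv]
  have hvu' : (v : B) ^ n = u := by rw [← Units.val_zpow_eq_zpow_val, hvu]
  have a1 : (u : B) ^ (-2 * m) = ((v : B) ^ 2)⁻¹ := by
    rw [mul_comm, zpow_mul, huv', zpow_neg]; norm_cast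
  have a2 : (v : B) ^ (-2 * n) = ((u : B) ^ 2)⁻¹ := by
    rw [mul_comm, zpow_mul, hvu', zpow_neg]; norm_cast
  have hv4 : (v : B) ^ 4 ≠ 1 := fun h => hv (Units.ext (by simpa using h))
  rw [hopfDiagram_alexander _ _ _ (by cases ε 0 <;> simp) (by cases ε 1 <;> simp)
    (by cases ε 1 <;> simpa using hv4), Fin.prod_univ_two]
  cases ε 0 <;> cases ε 1 <;>
    simp only [Matrix.cons_val_zero, Matrix.cons_val_one, if_true, if_false, Bool.false_eq_true,
      Bool.true_eq_false, Units.val_inv_eq_inv_val, inv_zpow, a1, a2, inv_inv] <;>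
    field_simp

/-- The four equal terms of the expansion of the Kirby colors cancel the factor `2 ^ 2` in the
normalization. -/
theorem hopfDiagram_invariant {B : Type*} [Field B] [CharZero B] (m n : ℤ) (u v : Bˣ)
    (huv : u ^ m = v) (hvu : v ^ n = u) (hv : v ^ 4 ≠ 1) :
    (hopfDiagram m n).invariant ![u, v] =
        (-1) ^ ((hopfDiagram m n).sigmaPos + 1) * d (u : B) * d (v : B) := by
  rw [LinkDiagram.invariant, LinkDiagram.kirbyAlexander]
  rw [Finset.sum_congr rfl fun ε _ => kirby_term m n u v huv hvu hv ε]
  simp only [Finset.sum_const, Finset.card_univ, Fintype.card_fun, Fintype.card_bool,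
    Fintype.card_fin]
  rcases neg_one_pow_eq_or B (hopfDiagram m n).sigmaPos with h | h <;>
    rw [pow_succ (-1 : B), h] <;> norm_num <;> ring

/-! ### The linking matrix -/

/-- A curl contributes its sign to the self-crossings of its component. -/
theorem signSum_curl {ι : Type*} [DecidableEq ι] (i j : ι) (P Q : List (Strand ι)) (k : ι)
    (up pos : Bool) (w : List (Slice ι)) :
    signSum i j (.cup (P.length + 1) k up :: .cross P.length pos :: .cap (P.length + 1) :: w)
        (P ++ ⟨k, up⟩ :: Q) =
      (if k = i ∧ k = j then (if pos then 1 else -1) else 0) + signSum i j w (P ++ ⟨k, up⟩ :: Q) := by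
  have e1 := next_cup_curl P Q k up
  have e2 := next_cross_curl P Q k up pos
  have e3 := next_cap_curl P Q k up
  simp only [signSum, e1, e2, e3]
  simp [and_comm]

theorem signSum_twists (i j : Fin 2) (P Q : List (Strand (Fin 2))) (k : Fin 2) (m : ℤ)
    (w : List (Slice (Fin 2))) :
    signSum i j (twists P.length k m ++ w) (P ++ ⟨k, true⟩ :: Q) =
      (if k = i ∧ k = j then m else 0) + signSum i j w (P ++ ⟨k, true⟩ :: Q) := by
  have key (r : ℕ) : signSum i j
        ((List.replicate r (curl P.length k (decide (0 < m)))).flatten ++ w) (P ++ ⟨k, true⟩ :: Q) =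
      (if k = i ∧ k = j then (if 0 < m then (r : ℤ) else -r) else 0) +
        signSum i j w (P ++ ⟨k, true⟩ :: Q) := by
    induction r with
    | zero => simp
    | succ r ih =>
      rw [List.replicate_succ, List.flatten_cons, List.append_assoc]
      refine (signSum_curl i j P Q k true _ _).trans ?_
      rw [List.append_eq, List.nil_append, ih]
      split_ifs <;> simp_all <;> ring
  rw [twists, key]
  split_ifs with h1 h2
  · rw [Int.natCast_natAbs, abs_of_pos h2]
  · rw [Int.natCast_natAbs, abs_of_nonpos (not_lt.1 h2), neg_neg]
  · rfl

theorem hopfDiagram_linkingMatrix (m n : ℤ) :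
    (hopfDiagram m n).linkingMatrix = !![m, -1; -1, n] := by
  have key (i j : Fin 2) : signSum i j (hopfDiagram m n).slices [(hopfDiagram m n).cut] =
      !![m, -2; -2, n] i j := by
    have e1 := signSum_twists i j [] [] 1 n
    have e2 := signSum_twists i j [⟨0, false⟩] [⟨1, true⟩] 0 m
    simp only [List.nil_append, List.length_nil] at e1
    simp only [hopfDiagram, hopfSlices]
    rw [e1]
    simp only [signSum]
    have e3 : (Slice.cup 0 0 false).next [⟨1, true⟩] =
        ([⟨0, false⟩] ++ ⟨0, true⟩ :: [⟨1, true⟩] : List (Strand (Fin 2))) := by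
      simp [Slice.next]
    rw [e3]
    erw [e2]
    fin_cases i <;> fin_cases j <;> simp [signSum, Slice.next]
  ext i j
  simp only [LinkDiagram.linkingMatrix, Matrix.of_apply, key]
  fin_cases i <;> fin_cases j <;> simp

/-! ### Homology classes of free loops -/

section LoopClass

open Path.Homotopic.Quotient (mk mk_trans mk_symm)

theorem symm_trans_cancel_left {X : Type*} [TopologicalSpace X] {x y z : X}
    (p : Path.Homotopic.Quotient x y) (q : Path.Homotopic.Quotient y z) :
    p.symm.trans (p.trans q) = q := by
  rw [← Path.Homotopic.Quotient.trans_assoc, Path.Homotopic.Quotient.symm_trans,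
    Path.Homotopic.Quotient.refl_trans]

theorem trans_symm_cancel_left {X : Type*} [TopologicalSpace X] {x y z : X}
    (p : Path.Homotopic.Quotient x y) (q : Path.Homotopic.Quotient x z) :
    p.trans (p.symm.trans q) = q := by
  rw [← Path.Homotopic.Quotient.trans_assoc, Path.Homotopic.Quotient.trans_symm,
    Path.Homotopic.Quotient.refl_trans]

/-- The class of a free loop can be computed with any path from the base point, since a change of
the path conjugates the loop, which does not matter in the abelianization. -/
theorem loopClass_eq_of_path {X : Type*} [TopologicalSpace X] {x₀ y : X} (γ : C(Circle, X))
    (p : Path x₀ y) (δ : Path y y) (hδ : ∀ t, δ t = γ (Circle.exp (2 * Real.pi * t))) :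
    loopClass x₀ γ =
      Abelianization.of (FundamentalGroup.fromPath (((mk p).trans (mk δ)).trans (mk p).symm)) := by
  obtain rfl : y = γ 1 := by simpa using hδ 0
  obtain rfl : δ = loopPath γ := by ext t; exact hδ t
  have h : Joined x₀ (γ 1) := ⟨p⟩
  rw [loopClass, dif_pos h]
  set q := h.somePath
  set c : FundamentalGroup X x₀ := FundamentalGroup.fromPath ((mk q).trans (mk p).symm) with hc
  set c' : FundamentalGroup X x₀ := FundamentalGroup.fromPath ((mk p).trans (mk q).symm) with hc'
  have hcc : c' * c = 1 := by
    rw [FundamentalGroup.mul_def, FundamentalGroup.one_def, hc, hc']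
    simp [FundamentalGroup.fromPath, FundamentalGroup.fromArrow, symm_trans_cancel_left]
  have key : (FundamentalGroup.fromPath (mk ((q.trans (loopPath γ)).trans q.symm)) :
      FundamentalGroup X x₀) = c' * FundamentalGroup.fromPath
        (((mk p).trans (mk (loopPath γ))).trans (mk p).symm) * c := by
    rw [FundamentalGroup.mul_def, FundamentalGroup.mul_def, hc, hc']
    simp [FundamentalGroup.fromPath, FundamentalGroup.fromArrow, symm_trans_cancel_left]
  rw [key, map_mul, map_mul, mul_right_comm, ← map_mul, hcc, map_one, one_mul]

theorem loopClass_eq_one_of_not_joined {X : Type*} [TopologicalSpace X] {x₀ : X}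
    {γ : C(Circle, X)} (h : ¬ Joined x₀ (γ 1)) : loopClass x₀ γ = 1 := dif_neg h

/-- The straight path between two points of the plane. -/
def linePath (u v : ℝ × ℝ) : Path u v where
  toFun t := u + (t : ℝ) • (v - u)
  source' := by simp
  target' := by simp

/-- The two ways along the boundary of a square are homotopic. -/
theorem mk_trans_mk_eq_of_square {X : Type*} [TopologicalSpace X] (H : C(ℝ × ℝ, X)) {a b c d : X}
    (bottom : Path a b) (right : Path b c) (left : Path a d) (top : Path d c)
    (hb : ∀ t, bottom t = H (t, 0)) (hr : ∀ t, right t = H (1, t))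
    (hl : ∀ t, left t = H (0, t)) (ht : ∀ t, top t = H (t, 1)) :
    (mk bottom).trans (mk right) = (mk left).trans (mk top) := by
  obtain rfl : a = H (0, 0) := by simpa using hb 0
  obtain rfl : b = H (1, 0) := by simpa using hr 0
  obtain rfl : d = H (0, 1) := by simpa using ht 0
  obtain rfl : c = H (1, 1) := by simpa using hr 1
  have e1 : bottom = (linePath (0, 0) (1, 0)).map H.continuous := by
    ext t; simp [hb, linePath]
  have e2 : right = (linePath (1, 0) (1, 1)).map H.continuous := by
    ext t; simp [hr, linePath]
  have e3 : left = (linePath (0, 0) (0, 1)).map H.continuous := by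
    ext t; simp [hl, linePath]
  have e4 : top = (linePath (0, 1) (1, 1)).map H.continuous := by
    ext t; simp [ht, linePath]
  rw [e1, e2, e3, e4, ← mk_trans, ← mk_trans, ← Path.map_trans, ← Path.map_trans]
  exact Path.Homotopic.Quotient.eq.2 ((SimplyConnectedSpace.paths_homotopic _ _).map H)

/-- The diagonal of a square is homotopic to the way along two sides. -/
theorem mk_diag_eq {X : Type*} [TopologicalSpace X] (H : C(ℝ × ℝ, X)) {a b c : X}
    (bottom : Path a b) (right : Path b c) (diag : Path a c)
    (hb : ∀ t, bottom t = H (t, 0)) (hr : ∀ t, right t = H (1, t))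
    (hd : ∀ t : unitInterval, diag t = H (t, t)) :
    mk diag = (mk bottom).trans (mk right) := by
  obtain rfl : a = H (0, 0) := by simpa using hb 0
  obtain rfl : b = H (1, 0) := by simpa using hr 0
  obtain rfl : c = H (1, 1) := by simpa using hr 1
  have e1 : bottom = (linePath (0, 0) (1, 0)).map H.continuous := by
    ext t; simp [hb, linePath]
  have e2 : right = (linePath (1, 0) (1, 1)).map H.continuous := by
    ext t; simp [hr, linePath]
  have e3 : diag = (linePath (0, 0) (1, 1)).map H.continuous := by
    ext t; simp [hd, linePath]
  rw [e1, e2, e3, ← mk_trans, ← Path.map_trans]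
  exact Path.Homotopic.Quotient.eq.2 ((SimplyConnectedSpace.paths_homotopic _ _).map H)

/-- Freely homotopic loops have the same class. -/
theorem loopClass_eq_of_homotopic {X : Type*} [TopologicalSpace X] (x₀ : X) {γ γ' : C(Circle, X)}
    (h : γ.Homotopic γ') : loopClass x₀ γ = loopClass x₀ γ' := by
  obtain ⟨F⟩ := h
  set σ : Path (γ 1) (γ' 1) := F.evalAt 1
  by_cases hj : Joined x₀ (γ 1)
  · obtain ⟨p⟩ := hj
    rw [loopClass_eq_of_path γ p (loopPath γ) fun _ => rfl,
      loopClass_eq_of_path γ' (p.trans σ) (loopPath γ') fun _ => rfl]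
    have hsq := mk_trans_mk_eq_of_square
      ⟨fun q : ℝ × ℝ => F (Set.projIcc 0 1 zero_le_one q.1, Circle.exp (2 * Real.pi * q.2)), by
        fun_prop⟩ σ (loopPath γ') (loopPath γ) σ
      (by intro t; simp [σ]) (by intro t; simp; rfl) (by intro t; simp; rfl)
      (by intro t; simp [σ])
    congr 2
    rw [← mk_symm (p.trans σ), Path.trans_symm, mk_trans, mk_trans,
      Path.Homotopic.Quotient.trans_assoc (mk p) (mk σ), hsq]
    simp [trans_symm_cancel_left]
  · have hj' : ¬ Joined x₀ (γ' 1) := fun h' => hj (h'.trans ⟨σ.symm⟩)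
    rw [loopClass_eq_one_of_not_joined hj, loopClass_eq_one_of_not_joined hj']

theorem loopClass_const {X : Type*} [TopologicalSpace X] (x₀ y : X) :
    loopClass x₀ (ContinuousMap.const Circle y) = 1 := by
  by_cases hj : Joined x₀ y
  · obtain ⟨p⟩ := hj
    rw [loopClass_eq_of_path _ p (Path.refl y) fun _ => rfl]
    have : (FundamentalGroup.fromPath (((mk p).trans (mk (Path.refl y))).trans (mk p).symm)) =
        (1 : FundamentalGroup X x₀) := by
      rw [FundamentalGroup.one_def]
      simp [FundamentalGroup.fromPath, FundamentalGroup.fromArrow]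
    rw [this, map_one]
  · exact loopClass_eq_one_of_not_joined hj

/-- Eckmann–Hilton: for loops in a topological monoid the pointwise product is homotopic to the
concatenation, because it is the diagonal of the square `(s, t) ↦ α t * β s`. -/
theorem loopClass_comp_mul {X T : Type*} [TopologicalSpace X] [TopologicalSpace T] [Monoid T]
    [ContinuousMul T] (x₀ : X) (F : C(T, X)) (α β : C(Circle, T)) (hα : α 1 = 1) (hβ : β 1 = 1) :
    loopClass x₀ (F.comp (α * β)) = loopClass x₀ (F.comp α) * loopClass x₀ (F.comp β) := by
  by_cases hj : Joined x₀ (F 1)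
  · obtain ⟨p⟩ := hj
    let δ (α : C(Circle, T)) (hα : α 1 = 1) : Path (F 1) (F 1) :=
      (loopPath (F.comp α)).cast (by simp [hα]) (by simp [hα])
    have hδ (α : C(Circle, T)) (hα : α 1 = 1) (t : unitInterval) :
        δ α hα t = F (α (Circle.exp (2 * Real.pi * t))) := rfl
    have hd := mk_diag_eq
      ⟨fun q : ℝ × ℝ => F (α (Circle.exp (2 * Real.pi * q.2)) * β (Circle.exp (2 * Real.pi * q.1))),
        by fun_prop⟩ (δ β hβ) (δ α hα) (δ (α * β) (by simp [hα, hβ]))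
      (by intro t; simp [hδ, hα]) (by intro t; simp [hδ, hβ]) (by intro t; simp [hδ])
    rw [loopClass_eq_of_path _ p (δ (α * β) (by simp [hα, hβ])) fun _ => rfl,
      loopClass_eq_of_path _ p (δ α hα) fun _ => rfl,
      loopClass_eq_of_path _ p (δ β hβ) fun _ => rfl, ← map_mul, FundamentalGroup.mul_def, hd]
    congr 1
    simp [FundamentalGroup.fromPath, FundamentalGroup.fromArrow, symm_trans_cancel_left]
  · rw [loopClass_eq_one_of_not_joined, loopClass_eq_one_of_not_joined,
      loopClass_eq_one_of_not_joined, one_mul] <;> simpa [hα, hβ] using hj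

theorem loopClass_comp_zpow {X T : Type*} [TopologicalSpace X] [TopologicalSpace T] [Group T]
    [IsTopologicalGroup T] (x₀ : X) (F : C(T, X)) (α : C(Circle, T)) (hα : α 1 = 1) (k : ℤ) :
    loopClass x₀ (F.comp (α ^ k)) = loopClass x₀ (F.comp α) ^ k := by
  let f : Multiplicative ℤ →* H1 X x₀ := MonoidHom.mk'
    (fun k => loopClass x₀ (F.comp (α ^ k.toAdd))) fun a b => by
      rw [toAdd_mul, zpow_add]
      exact loopClass_comp_mul x₀ F _ _ (by simp [hα]) (by simp [hα])
  have h := map_zpow f (Multiplicative.ofAdd 1) k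
  rw [← ofAdd_zsmul] at h
  simpa [f] using h

/-- A loop which bounds a disk has trivial class. -/
theorem loopClass_eq_one_of_disk {X : Type*} [TopologicalSpace X] (x₀ : X) (γ : C(Circle, X))
    (h : C(Disk, X)) (hγ : ∀ x, γ x = h (circleToDisk x)) : loopClass x₀ γ = 1 := by
  have H : γ.Homotopic (ContinuousMap.const Circle (h ⟨0, by simp⟩)) := by
    refine ⟨⟨⟨fun q => h ⟨((1 - (q.1 : ℝ) : ℝ) : ℂ) * q.2, ?_⟩, ?_⟩, ?_, ?_⟩⟩
    · rw [norm_mul, Circle.norm_coe, mul_one, Complex.norm_real, Real.norm_eq_abs, abs_le]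
      constructor <;> linarith [q.1.2.1, q.1.2.2]
    · refine h.continuous.comp (Continuous.subtype_mk ?_ _)
      fun_prop
    · intro x
      simp [hγ, circleToDisk]
    · intro x
      simp
  rw [loopClass_eq_of_homotopic x₀ H, loopClass_const]

end LoopClass

/-! ### The exterior of the Hopf link and the homology of the surgered manifold -/

/-- The point of the circle in the direction of a nonzero complex number. -/
def circleDir (z : ℂ) (hz : z ≠ 0) : Circle := ⟨z / ‖z‖, by simp [Submonoid.unitSphere, hz]⟩

theorem norm_mul_circleDir (z : ℂ) (hz : z ≠ 0) : (‖z‖ : ℂ) * circleDir z hz = z := by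
  have : (‖z‖ : ℂ) ≠ 0 := by simpa using hz
  simp only [circleDir]
  field_simp

theorem circleDir_mul {r : ℝ} (hr : 0 < r) (a : Circle) (h : (r : ℂ) * a ≠ 0) :
    circleDir ((r : ℂ) * a) h = a := by
  refine circle_eq_of_mul_eq (norm_pos_iff.2 h) hr ?_
  rw [norm_mul_circleDir]

theorem exists_norm_mul_circle (z : ℂ) : ∃ a : Circle, z = (‖z‖ : ℂ) * a := by
  by_cases hz : z = 0
  · exact ⟨1, by simp [hz]⟩
  · exact ⟨circleDir z hz, (norm_mul_circleDir z hz).symm⟩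

theorem hopfNbhd_zero_norm_snd (m n : ℤ) (x : Circle) (z : Disk) :
    ‖(hopfNbhd m n 0 x z).2‖ = ‖(z : ℂ)‖ / 2 := by
  simp only [hopfNbhd, if_true, norm_div, norm_mul, Circle.norm_coe, one_mul, Complex.norm_ofNat]

theorem hopfNbhd_one_norm_fst (m n : ℤ) (x : Circle) (z : Disk) :
    ‖(hopfNbhd m n 1 x z).1‖ = ‖(z : ℂ)‖ / 2 := by
  simp only [hopfNbhd, one_ne_zero, if_false, norm_div, norm_mul, Circle.norm_coe, one_mul,
    Complex.norm_ofNat, RCLike.norm_conj]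

theorem coreRadius_eq {z : Disk} {r s : ℝ} (hr : 0 ≤ r) (hz : ‖(z : ℂ)‖ = 2 * s)
    (h : r ^ 2 + s ^ 2 = 1) : coreRadius z = r := by
  rw [coreRadius, hz, show 1 - (2 * s) ^ 2 / 4 = r ^ 2 by linear_combination -h, Real.sqrt_sq hr]

theorem exists_hopfNbhd_zero (m n : ℤ) (p : Sphere3) (hp : ‖p.1.2‖ ≤ 1 / 2) :
    ∃ x z, (hopfLink m n).nbhd 0 x z = p ∧ ‖(z : ℂ)‖ = 2 * ‖p.1.2‖ := by
  obtain ⟨a, ha⟩ := exists_norm_mul_circle p.1.1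
  have hn : ‖2 * ((a ^ m)⁻¹ : Circle) * p.1.2‖ = 2 * ‖p.1.2‖ := by
    rw [norm_mul, norm_mul, Circle.norm_coe, Complex.norm_ofNat, mul_one]
  refine ⟨a, ⟨2 * ((a ^ m)⁻¹ : Circle) * p.1.2, by rw [hn]; linarith⟩, ?_, hn⟩
  refine Subtype.ext (Prod.ext ?_ ?_)
  · simp only [hopfLink, hopfNbhd, if_true]
    rw [coreRadius_eq (norm_nonneg _) hn p.2, ← ha]
  · simp only [hopfLink, hopfNbhd, if_true, Circle.coe_inv]
    have := Circle.coe_ne_zero (a ^ m)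
    field_simp

theorem exists_hopfNbhd_one (m n : ℤ) (p : Sphere3) (hp : ‖p.1.1‖ ≤ 1 / 2) :
    ∃ x z, (hopfLink m n).nbhd 1 x z = p ∧ ‖(z : ℂ)‖ = 2 * ‖p.1.1‖ := by
  obtain ⟨a, ha⟩ := exists_norm_mul_circle p.1.2
  have hn : ‖2 * (((a⁻¹) ^ (-n)) : Circle) * starRingEnd ℂ p.1.1‖ = 2 * ‖p.1.1‖ := by
    rw [norm_mul, norm_mul, Circle.norm_coe, Complex.norm_ofNat, mul_one, RCLike.norm_conj]
  refine ⟨a⁻¹, ⟨2 * (((a⁻¹) ^ (-n)) : Circle) * starRingEnd ℂ p.1.1, by rw [hn]; linarith⟩, ?_, hn⟩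
  have hp2 := p.2
  refine Subtype.ext (Prod.ext ?_ ?_)
  · simp only [hopfLink, hopfNbhd, one_ne_zero, if_false, map_mul, ← Circle.coe_inv_eq_conj,
      Complex.conj_conj, map_ofNat]
    have := Circle.coe_ne_zero (a⁻¹ ^ (-n))
    rw [Circle.coe_inv]
    field_simp
  · simp only [hopfLink, hopfNbhd, one_ne_zero, if_false]
    rw [coreRadius_eq (norm_nonneg p.1.2) hn (by linarith), inv_inv, ← ha]

/-- The exterior of the Hopf link is given by `|z| ≥ 1/2` and `|w| ≥ 1/2`. -/
theorem hopfLink_mem_exterior_iff (m n : ℤ) (p : Sphere3) :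
    (∀ i x z, (hopfLink m n).nbhd i x z = p → ‖(z : ℂ)‖ = 1) ↔
      1 / 2 ≤ ‖p.1.1‖ ∧ 1 / 2 ≤ ‖p.1.2‖ := by
  constructor
  · intro h
    constructor
    · by_contra! hz
      obtain ⟨x, z, h1, h2⟩ := exists_hopfNbhd_one m n p hz.le
      linarith [h _ _ _ h1]
    · by_contra! hz
      obtain ⟨x, z, h1, h2⟩ := exists_hopfNbhd_zero m n p hz.le
      linarith [h _ _ _ h1]
  · rintro ⟨h1, h2⟩ i x z rfl
    have hz := z.2
    fin_cases i
    · have : ‖((hopfLink m n).nbhd 0 x z).1.2‖ = ‖(z : ℂ)‖ / 2 := hopfNbhd_zero_norm_snd m n x z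
      simp only [Fin.zero_eta, Fin.isValue] at h2
      linarith
    · have : ‖((hopfLink m n).nbhd 1 x z).1.1‖ = ‖(z : ℂ)‖ / 2 := hopfNbhd_one_norm_fst m n x z
      simp only [Fin.mk_one, Fin.isValue] at h1
      linarith

/-- The points of the torus of level `s` in the exterior, on which `|w|² = (1 + 2s)/4`. The level `0`
is the boundary of the tubular neighborhood of component `0`, the level `1` is that of
component `1`. -/
def levelTorus (m n : ℤ) (s : unitInterval) (a b : Circle) : (hopfLink m n).Exterior :=
  ⟨⟨((Real.sqrt ((3 - 2 * s) / 4) : ℂ) * a, (Real.sqrt ((1 + 2 * s) / 4) : ℂ) * b), by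
    have h1 := s.2.1
    have h2 := s.2.2
    simp only [norm_mul, Circle.norm_coe, Complex.norm_real, Real.norm_eq_abs, mul_one, sq_abs]
    rw [Real.sq_sqrt (by linarith), Real.sq_sqrt (by linarith)]
    ring⟩, by
    have h1 := s.2.1
    have h2 := s.2.2
    rw [hopfLink_mem_exterior_iff]
    simp only [norm_mul, Circle.norm_coe, Complex.norm_real, Real.norm_eq_abs, mul_one,
      abs_of_nonneg (Real.sqrt_nonneg _)]
    constructor <;> refine Real.le_sqrt_of_sq_le ?_ <;> linarith⟩

theorem continuous_levelTorus (m n : ℤ) :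
    Continuous fun q : unitInterval × Circle × Circle => levelTorus m n q.1 q.2.1 q.2.2 := by
  refine Continuous.subtype_mk (Continuous.subtype_mk ?_ _) _
  fun_prop

/-- The boundary of the neighborhood of component `0` in the coordinates of the torus of level `0`. -/
theorem nbhd_zero_boundary (m n : ℤ) (x y : Circle) :
    (hopfLink m n).nbhd 0 x (circleToDisk y) = (levelTorus m n 0 x (x ^ m * y)).1 := by
  refine Subtype.ext (Prod.ext ?_ ?_)
  · simp only [hopfLink, hopfNbhd, if_true, levelTorus, coreRadius, circleToDisk, Circle.norm_coe]
    norm_num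
  · simp only [hopfLink, hopfNbhd, if_true, levelTorus, circleToDisk, Circle.coe_mul]
    rw [show ((1 + 2 * ((0 : unitInterval) : ℝ)) / 4) = (1 / 2) ^ 2 by norm_num,
      Real.sqrt_sq (by norm_num)]
    push_cast
    ring

/-- The boundary of the neighborhood of component `1` in the coordinates of the torus of level `1`. -/
theorem nbhd_one_boundary (m n : ℤ) (x y : Circle) :
    (hopfLink m n).nbhd 1 x (circleToDisk y) = (levelTorus m n 1 (x ^ (-n) * y⁻¹) x⁻¹).1 := by
  refine Subtype.ext (Prod.ext ?_ ?_)
  · simp only [hopfLink, hopfNbhd, one_ne_zero, if_false, levelTorus, circleToDisk, Circle.coe_mul,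
      Circle.coe_inv_eq_conj y]
    rw [show ((3 - 2 * ((1 : unitInterval) : ℝ)) / 4) = (1 / 2) ^ 2 by norm_num,
      Real.sqrt_sq (by norm_num)]
    push_cast
    ring
  · simp only [hopfLink, hopfNbhd, one_ne_zero, if_false, levelTorus, coreRadius, circleToDisk,
      Circle.norm_coe]
    norm_num

/-- The torus of level `s`, as a map into the surgered manifold. -/
def torusMap (m n : ℤ) (s : unitInterval) : C(Circle × Circle, (hopfLink m n).Surgery) where
  toFun q := Quot.mk _ (.inl (levelTorus m n s q.1 q.2))
  continuous_toFun := continuous_quot_mk.comp (continuous_inl.comp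
    ((continuous_levelTorus m n).comp (Continuous.prodMk continuous_const continuous_id)))

theorem torusMap_homotopic (m n : ℤ) : (torusMap m n 0).Homotopic (torusMap m n 1) :=
  ⟨⟨⟨fun q => torusMap m n q.1 q.2, continuous_quot_mk.comp (continuous_inl.comp
    (continuous_levelTorus m n))⟩, fun _ => rfl, fun _ => rfl⟩⟩

/-- The first coordinate circle of the torus. -/
def torusFst : C(Circle, Circle × Circle) := ⟨fun x => (x, 1), by fun_prop⟩

/-- The second coordinate circle of the torus. -/
def torusSnd : C(Circle, Circle × Circle) := ⟨fun x => (1, x), by fun_prop⟩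

theorem meridian_zero_eq (m n : ℤ) :
    (hopfLink m n).meridian 0 = (torusMap m n 0).comp torusSnd := by
  ext y
  refine congrArg (fun p => Quot.mk _ (Sum.inl p)) (Subtype.ext ?_)
  simpa [torusSnd] using nbhd_zero_boundary m n 1 y

theorem meridian_one_eq (m n : ℤ) :
    (hopfLink m n).meridian 1 = (torusMap m n 1).comp torusFst⁻¹ := by
  ext y
  refine congrArg (fun p => Quot.mk _ (Sum.inl p)) (Subtype.ext ?_)
  simpa [torusFst] using nbhd_one_boundary m n 1 y

theorem surgeryRel_zero (m n : ℤ) (x y : Circle) :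
    (hopfLink m n).surgeryRel (.inl (levelTorus m n 0 x (x ^ m * y)))
      (.inr ⟨0, circleToDisk x, y⟩) :=
  ⟨x, rfl, (nbhd_zero_boundary m n x y).symm⟩

theorem surgeryRel_one (m n : ℤ) (x y : Circle) :
    (hopfLink m n).surgeryRel (.inl (levelTorus m n 1 (x ^ (-n) * y⁻¹) x⁻¹))
      (.inr ⟨1, circleToDisk x, y⟩) :=
  ⟨x, rfl, (nbhd_one_boundary m n x y).symm⟩

theorem surgery_mk_zero (m n : ℤ) (x y : Circle) :
    torusMap m n 0 (x, x ^ m * y) =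
      (Quot.mk _ (.inr ⟨0, circleToDisk x, y⟩) : (hopfLink m n).Surgery) :=
  Quot.sound (surgeryRel_zero m n x y)

theorem surgery_mk_one (m n : ℤ) (x y : Circle) :
    torusMap m n 1 (x ^ (-n) * y⁻¹, x⁻¹) =
      (Quot.mk _ (.inr ⟨1, circleToDisk x, y⟩) : (hopfLink m n).Surgery) :=
  Quot.sound (surgeryRel_one m n x y)

/-- The meridian disk of a glued solid torus, as a disk in the surgered manifold. -/
def meridianDisk {ι : Type*} (L : FramedLink ι) (i : ι) : C(Disk, L.Surgery) where
  toFun z := Quot.mk _ (.inr ⟨i, z, 1⟩)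
  continuous_toFun := continuous_quot_mk.comp (continuous_inr.comp
    (continuous_sigmaMk.comp (Continuous.prodMk continuous_id continuous_const)))

/-- The class of the curve `x ↦ (x ^ j, x ^ k)` on a level torus in terms of the meridians. -/
theorem loopClass_torusMap (m n : ℤ) (x₀ : (hopfLink m n).Surgery) (j k : ℤ) :
    loopClass x₀ ((torusMap m n 0).comp (torusFst ^ j * torusSnd ^ k)) =
      loopClass x₀ ((hopfLink m n).meridian 1) ^ (-j) *
        loopClass x₀ ((hopfLink m n).meridian 0) ^ k := by
  have h1 : torusFst 1 = 1 := rfl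
  have h1' : torusFst⁻¹ 1 = 1 := by rw [ContinuousMap.inv_apply, h1, inv_one]
  have h2 : torusSnd 1 = 1 := rfl
  have h3 : loopClass x₀ ((hopfLink m n).meridian 1) =
      loopClass x₀ ((torusMap m n 0).comp torusFst⁻¹) := by
    rw [meridian_one_eq]
    exact (loopClass_eq_of_homotopic x₀
      ((torusMap_homotopic m n).comp (.refl _))).symm
  rw [loopClass_comp_mul _ _ _ _ (by simp [h1]) (by simp [h2]), loopClass_comp_zpow _ _ _ h2, h3,
    ← loopClass_comp_zpow x₀ _ torusFst⁻¹ h1' (-j), meridian_zero_eq, inv_zpow, zpow_neg, inv_inv]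

/-- The parallel of component `0` is `(x, x ^ m)` on the level torus, and it bounds a disk. -/
theorem meridian_zero_zpow (m n : ℤ) (x₀ : (hopfLink m n).Surgery) :
    loopClass x₀ ((hopfLink m n).meridian 0) ^ m = loopClass x₀ ((hopfLink m n).meridian 1) := by
  have h := loopClass_torusMap m n x₀ 1 m
  rw [loopClass_eq_one_of_disk x₀ _ (meridianDisk (hopfLink m n) 0)] at h
  · rw [zpow_neg, zpow_one] at h
    exact (inv_mul_eq_one.1 h.symm).symm
  · intro x
    refine Eq.trans ?_ (surgery_mk_zero m n x 1)
    simp [torusFst, torusSnd]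

/-- The parallel of component `1` is `(x ^ (-n), x⁻¹)` on the level torus, and it bounds a disk. -/
theorem meridian_one_zpow (m n : ℤ) (x₀ : (hopfLink m n).Surgery) :
    loopClass x₀ ((hopfLink m n).meridian 1) ^ n = loopClass x₀ ((hopfLink m n).meridian 0) := by
  have h := loopClass_torusMap m n x₀ (-n) (-1)
  rw [← loopClass_eq_of_homotopic x₀ ((torusMap_homotopic m n).symm.comp (.refl _)),
    loopClass_eq_one_of_disk x₀ _ (meridianDisk (hopfLink m n) 1)] at h
  · rw [zpow_neg _ 1, zpow_one, neg_neg] at h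
    exact mul_inv_eq_one.1 h.symm
  · intro x
    refine Eq.trans ?_ (surgery_mk_one m n x 1)
    simp [torusFst, torusSnd]

/-! ### The surgered manifold is a lens space -/

/-- A quotient map `g` induces a homeomorphism of quotients if the points which `g` identifies are
identified in the first quotient and the generating relations correspond to each other. -/
def quotHomeomorph {A C : Type*} [TopologicalSpace A] [TopologicalSpace C] {R : A → A → Prop}
    {S : C → C → Prop} {g : A → C} (hg : Topology.IsQuotientMap g)
    (h₁ : ∀ a b, R a b → Quot.mk S (g a) = Quot.mk S (g b))
    (h₂ : ∀ a b, g a = g b → Quot.mk R a = Quot.mk R b)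
    (h₃ : ∀ c c', S c c' → ∃ a b, g a = c ∧ g b = c' ∧ Quot.mk R a = Quot.mk R b) :
    Quot R ≃ₜ Quot S :=
  have hinv (c : C) : g (Function.surjInv hg.surjective c) = c := Function.surjInv_eq _ c
  { toFun := Quot.lift (fun a => Quot.mk S (g a)) h₁
    invFun := Quot.lift (fun c => Quot.mk R (Function.surjInv hg.surjective c)) fun c c' h => by
      obtain ⟨a, b, rfl, rfl, hab⟩ := h₃ c c' h
      exact (h₂ _ _ (hinv _)).trans (hab.trans (h₂ _ _ (hinv _)).symm)
    left_inv := by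
      rintro ⟨a⟩
      exact h₂ _ _ (hinv _)
    right_inv := by
      rintro ⟨c⟩
      exact congrArg (Quot.mk S) (hinv c)
    continuous_toFun := continuous_quot_lift h₁ (continuous_quot_mk.comp hg.continuous)
    continuous_invFun := by
      refine continuous_quot_lift _ (hg.continuous_iff.2 ?_)
      refine (continuous_quot_mk (r := R)).congr fun a => ?_
      exact (h₂ _ _ (hinv (g a))).symm }

theorem exterior_fst_ne_zero {m n : ℤ} (p : (hopfLink m n).Exterior) : p.1.1.1 ≠ 0 := by
  have := ((hopfLink_mem_exterior_iff m n p.1).1 p.2).1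
  exact norm_pos_iff.1 (by linarith)

theorem exterior_snd_ne_zero {m n : ℤ} (p : (hopfLink m n).Exterior) : p.1.1.2 ≠ 0 := by
  have := ((hopfLink_mem_exterior_iff m n p.1).1 p.2).2
  exact norm_pos_iff.1 (by linarith)

/-- The argument of `z` at a point `(z, w)` of the exterior. -/
def exteriorFst {m n : ℤ} (p : (hopfLink m n).Exterior) : Circle :=
  circleDir p.1.1.1 (exterior_fst_ne_zero p)

/-- The argument of `w` at a point `(z, w)` of the exterior. -/
def exteriorSnd {m n : ℤ} (p : (hopfLink m n).Exterior) : Circle :=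
  circleDir p.1.1.2 (exterior_snd_ne_zero p)

/-- The level `s` of the torus through a point of the exterior. -/
def exteriorLevel {m n : ℤ} (p : (hopfLink m n).Exterior) : unitInterval :=
  ⟨2 * ‖p.1.1.2‖ ^ 2 - 1 / 2, by
    have h := (hopfLink_mem_exterior_iff m n p.1).1 p.2
    have h2 := p.1.2
    constructor <;> nlinarith⟩

theorem continuous_exteriorFst (m n : ℤ) :
    Continuous (exteriorFst : (hopfLink m n).Exterior → Circle) := by
  refine Continuous.subtype_mk (Continuous.div (by fun_prop) (by fun_prop) fun p => ?_) _
  simpa using exterior_fst_ne_zero p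

theorem continuous_exteriorSnd (m n : ℤ) :
    Continuous (exteriorSnd : (hopfLink m n).Exterior → Circle) := by
  refine Continuous.subtype_mk (Continuous.div (by fun_prop) (by fun_prop) fun p => ?_) _
  simpa using exterior_snd_ne_zero p

theorem continuous_exteriorLevel (m n : ℤ) :
    Continuous (exteriorLevel : (hopfLink m n).Exterior → unitInterval) :=
  Continuous.subtype_mk (by fun_prop) _

theorem levelTorus_coordinates {m n : ℤ} (p : (hopfLink m n).Exterior) :
    levelTorus m n (exteriorLevel p) (exteriorFst p) (exteriorSnd p) = p := by
  have h := p.1.2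
  have e1 : (3 - 2 * (exteriorLevel p : ℝ)) / 4 = ‖p.1.1.1‖ ^ 2 := by
    simp only [exteriorLevel]; linarith
  have e2 : (1 + 2 * (exteriorLevel p : ℝ)) / 4 = ‖p.1.1.2‖ ^ 2 := by
    simp only [exteriorLevel]; ring
  refine Subtype.ext (Subtype.ext (Prod.ext ?_ ?_))
  · simp only [levelTorus]
    rw [e1, Real.sqrt_sq (norm_nonneg _)]
    exact norm_mul_circleDir _ _
  · simp only [levelTorus]
    rw [e2, Real.sqrt_sq (norm_nonneg _)]
    exact norm_mul_circleDir _ _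

theorem exteriorFst_levelTorus (m n : ℤ) (s : unitInterval) (a b : Circle) :
    exteriorFst (levelTorus m n s a b) = a :=
  circleDir_mul (Real.sqrt_pos.2 (by linarith [s.2.2])) a _

theorem exteriorSnd_levelTorus (m n : ℤ) (s : unitInterval) (a b : Circle) :
    exteriorSnd (levelTorus m n s a b) = b :=
  circleDir_mul (Real.sqrt_pos.2 (by linarith [s.2.1])) b _

theorem exteriorLevel_levelTorus (m n : ℤ) (s : unitInterval) (a b : Circle) :
    exteriorLevel (levelTorus m n s a b) = s := by
  refine Subtype.ext ?_
  simp only [exteriorLevel, levelTorus, norm_mul, Circle.norm_coe, Complex.norm_real,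
    Real.norm_eq_abs, mul_one, sq_abs]
  rw [Real.sq_sqrt (by linarith [s.2.1])]
  ring

/-- The exterior of the Hopf link is a thickened torus. -/
def exteriorHomeomorph (m n : ℤ) : (hopfLink m n).Exterior ≃ₜ unitInterval × Circle × Circle where
  toFun p := (exteriorLevel p, exteriorFst p, exteriorSnd p)
  invFun q := levelTorus m n q.1 q.2.1 q.2.2
  left_inv := levelTorus_coordinates
  right_inv _ := Prod.ext (exteriorLevel_levelTorus _ _ _ _ _)
    (Prod.ext (exteriorFst_levelTorus _ _ _ _ _) (exteriorSnd_levelTorus _ _ _ _ _))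
  continuous_toFun := (continuous_exteriorLevel m n).prodMk
    ((continuous_exteriorFst m n).prodMk (continuous_exteriorSnd m n))
  continuous_invFun := continuous_levelTorus m n

instance : CompactSpace Disk :=
  isCompact_iff_compactSpace (s := {z : ℂ | ‖z‖ ≤ 1}).1 (by
    simpa [Metric.closedBall] using isCompact_closedBall (0 : ℂ) 1)

/-- The thickened torus as the part `1/2 ≤ |z|` of a solid torus. The level `0`, where the solid
torus of component `0` is glued on, becomes the inner boundary. The first coordinate is
conjugated, so that the outer boundary is glued in the convention of `lensRel`. -/
def collar (m : ℤ) (q : unitInterval × Circle × Circle) : Disk × Circle :=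
  (⟨(((1 + q.1) / 2 : ℝ) : ℂ) * (q.2.1⁻¹ : Circle), by
    rw [norm_mul, Circle.norm_coe, mul_one, Complex.norm_real, Real.norm_eq_abs, abs_le]
    constructor <;> linarith [q.1.2.1, q.1.2.2]⟩, q.2.1 ^ (-m) * q.2.2)

/-- The solid torus of component `0` as the part `|z| ≤ 1/2` of a solid torus, conjugated in the same
way as the collar. -/
def shrink (q : Disk × Circle) : Disk × Circle :=
  (⟨starRingEnd ℂ (q.1 : ℂ) / 2, by
    rw [norm_div, RCLike.norm_conj, Complex.norm_ofNat]; linarith [q.1.2]⟩, q.2)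

/-- The exterior and the solid torus of component `0` are mapped to the first solid torus of the
lens space, the solid torus of component `1` to the second one. -/
def surgeryToTori (m n : ℤ) :
    (hopfLink m n).Exterior ⊕ (Σ _ : Fin 2, Disk × Circle) → (Disk × Circle) ⊕ (Disk × Circle)
  | .inl p => .inl (collar m (exteriorHomeomorph m n p))
  | .inr ⟨i, q⟩ => if i = 0 then .inl (shrink q) else .inr q

theorem continuous_surgeryToTori (m n : ℤ) : Continuous (surgeryToTori m n) := by
  refine continuous_sum_dom.2 ⟨?_, continuous_sigma fun i => ?_⟩
  · have hc : Continuous (collar m) :=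
      Continuous.prodMk (Continuous.subtype_mk (by fun_prop) _) (by fun_prop)
    exact continuous_inl.comp (hc.comp (exteriorHomeomorph m n).continuous)
  · fin_cases i
    · refine continuous_inl.comp (Continuous.prodMk (Continuous.subtype_mk ?_ _) continuous_snd)
      have h1 : Continuous fun q : Disk × Circle => (q.1 : ℂ) :=
        continuous_subtype_val.comp continuous_fst
      exact (Complex.continuous_conj.comp h1).div_const 2
    · exact continuous_inr

theorem collar_eq_iff (m : ℤ) (q q' : unitInterval × Circle × Circle) :
    collar m q = collar m q' ↔ q = q' := by
  refine ⟨fun h => ?_, congrArg _⟩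
  obtain ⟨s, a, b⟩ := q
  obtain ⟨s', a', b'⟩ := q'
  have h1 := congrArg Subtype.val (congrArg Prod.fst h)
  have h2 := congrArg Prod.snd h
  simp only [collar] at h1 h2
  have ha := circle_eq_of_mul_eq (by linarith [s.2.1]) (by linarith [s'.2.1]) h1
  obtain rfl := inv_injective ha
  obtain rfl := mul_left_cancel h2
  have hs := mul_right_cancel₀ (Circle.coe_ne_zero _) h1
  rw [Complex.ofReal_inj] at hs
  obtain rfl : s = s' := Subtype.ext (by linarith)
  rfl

theorem shrink_injective : Function.Injective shrink := by
  rintro ⟨z, y⟩ ⟨z', y'⟩ h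
  have h1 := congrArg Subtype.val (congrArg Prod.fst h)
  obtain rfl : y = y' := congrArg Prod.snd h
  simp only [shrink] at h1
  have hz : z = z' := Subtype.ext ((starRingEnd ℂ).injective (by linear_combination 2 * h1))
  rw [hz]

/-- The collar and the shrunk solid torus overlap only in points which the surgery identifies. -/
theorem eq_of_collar_eq_shrink {m : ℤ} {s : unitInterval} {a b : Circle} {z : Disk} {y : Circle}
    (h : collar m (s, a, b) = shrink (z, y)) :
    s = 0 ∧ z = circleToDisk a ∧ b = a ^ m * y := by
  have h1 := congrArg Subtype.val (congrArg Prod.fst h)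
  have h2 : a ^ (-m) * b = y := congrArg Prod.snd h
  simp only [collar, shrink] at h1
  have h3 := congrArg norm h1
  rw [norm_mul, Circle.norm_coe, mul_one, Complex.norm_real, Real.norm_eq_abs, norm_div,
    RCLike.norm_conj, Complex.norm_ofNat, abs_of_nonneg (by linarith [s.2.1])] at h3
  have hs : s = 0 := Subtype.ext (le_antisymm (by simp; linarith [z.2]) s.2.1)
  subst hs
  refine ⟨rfl, Subtype.ext ((starRingEnd ℂ).injective ?_), ?_⟩
  · simp [circleToDisk, ← Circle.coe_inv_eq_conj] at h1 ⊢
    linear_combination -2 * h1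
  · rw [← h2, ← mul_assoc, ← zpow_add, add_neg_cancel, zpow_zero, one_mul]

theorem collar_zero (m : ℤ) (x y : Circle) :
    collar m (0, x, x ^ m * y) = shrink (circleToDisk x, y) := by
  refine Prod.ext (Subtype.ext ?_) ?_
  · simp only [collar, shrink, circleToDisk, Circle.coe_inv_eq_conj, Set.Icc.coe_zero]
    push_cast
    ring
  · simp [collar, shrink]

theorem surgeryToTori_surjective (m n : ℤ) : Function.Surjective (surgeryToTori m n) := by
  rintro (⟨z, y⟩ | q)
  · rcases le_total ‖(z : ℂ)‖ (1 / 2) with h | h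
    · refine ⟨.inr ⟨0, ⟨2 * starRingEnd ℂ (z : ℂ), ?_⟩, y⟩, ?_⟩
      · rw [norm_mul, RCLike.norm_conj, Complex.norm_ofNat]; linarith
      · simp only [surgeryToTori, if_true, shrink]
        congr 2
        refine Subtype.ext ?_
        simp only [map_mul, map_ofNat, Complex.conj_conj]
        ring
    · obtain ⟨a, ha⟩ := exists_norm_mul_circle (z : ℂ)
      refine ⟨.inl ((exteriorHomeomorph m n).symm
        (⟨2 * ‖(z : ℂ)‖ - 1, by linarith, by linarith [z.2]⟩, a⁻¹, a⁻¹ ^ m * y)), ?_⟩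
      simp only [surgeryToTori, Homeomorph.apply_symm_apply, collar]
      congr 1
      refine Prod.ext (Subtype.ext ?_) (by simp)
      refine Eq.trans ?_ ha.symm
      simp only [inv_inv]
      congr 2
      ring
  · exact ⟨.inr ⟨1, q⟩, rfl⟩

/-- A continuous surjection from a compact space to a Hausdorff space is a quotient map. -/
theorem isQuotientMap_surgeryToTori (m n : ℤ) : Topology.IsQuotientMap (surgeryToTori m n) := by
  have : CompactSpace (hopfLink m n).Exterior := (exteriorHomeomorph m n).symm.compactSpace
  exact (continuous_surgeryToTori m n).isClosedMap.isQuotientMap (continuous_surgeryToTori m n)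
    (surgeryToTori_surjective m n)

/-- The gluing of the solid torus of component `1` becomes the gluing of the lens space with
`r = m` and `s = 1`. -/
theorem surgeryToTori_levelTorus_one (m n : ℤ) (x y : Circle) :
    surgeryToTori m n (.inl (levelTorus m n 1 (x ^ (-n) * y⁻¹) x⁻¹)) =
      .inl (circleToDisk (x ^ n * y ^ (1 : ℤ)), x ^ (m * n - 1) * y ^ m) := by
  have h : exteriorHomeomorph m n (levelTorus m n 1 (x ^ (-n) * y⁻¹) x⁻¹) =
      (1, x ^ (-n) * y⁻¹, x⁻¹) := (exteriorHomeomorph m n).apply_symm_apply (1, _, _)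
  simp only [surgeryToTori, h, collar]
  congr 1
  refine Prod.ext (Subtype.ext ?_) ?_
  · simp [circleToDisk, mul_comm]
  · simp only [mul_zpow, ← zpow_mul, inv_zpow', mul_neg, neg_mul, neg_neg]
    rw [zpow_sub, zpow_one, mul_comm n m, mul_right_comm]

theorem isLensSpace_hopfLink_surgery (m n : ℤ) :
    IsLensSpace (hopfLink m n).Surgery (m * n - 1) n := by
  refine ⟨m, 1, by ring, ⟨quotHomeomorph (isQuotientMap_surgeryToTori m n) ?_ ?_ ?_⟩⟩
  · rintro (p | q) (p' | ⟨i, z, y⟩) h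
    · exact h.elim
    · obtain ⟨x, rfl, hp⟩ := h
      fin_cases i
      · obtain rfl : p = levelTorus m n 0 x (x ^ m * y) :=
          Subtype.ext (hp.trans (nbhd_zero_boundary m n x y))
        refine congrArg _ ?_
        have h : exteriorHomeomorph m n (levelTorus m n 0 x (x ^ m * y)) = (0, x, x ^ m * y) :=
          (exteriorHomeomorph m n).apply_symm_apply (0, _, _)
        simp only [surgeryToTori, h, collar_zero]
        simp
      · obtain rfl : p = levelTorus m n 1 (x ^ (-n) * y⁻¹) x⁻¹ :=
          Subtype.ext (hp.trans (nbhd_one_boundary m n x y))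
        rw [surgeryToTori_levelTorus_one]
        exact Quot.sound ⟨x, rfl, rfl⟩
    · exact h.elim
    · exact h.elim
  · have key (p : (hopfLink m n).Exterior) (z : Disk) (y : Circle)
        (h : collar m (exteriorHomeomorph m n p) = shrink (z, y)) :
        Quot.mk (hopfLink m n).surgeryRel (.inl p) = Quot.mk _ (.inr ⟨0, z, y⟩) := by
      obtain ⟨⟨s, a, b⟩, rfl⟩ := (exteriorHomeomorph m n).symm.surjective p
      rw [Homeomorph.apply_symm_apply] at h
      obtain ⟨rfl, rfl, rfl⟩ := eq_of_collar_eq_shrink h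
      exact Quot.sound (surgeryRel_zero m n a y)
    rintro (p | ⟨i, q⟩) (p' | ⟨i', q'⟩) h
    · have := (collar_eq_iff m _ _).1 (Sum.inl_injective h)
      rw [(exteriorHomeomorph m n).injective this]
    · fin_cases i'
      · exact key _ _ _ (Sum.inl_injective h)
      · exact absurd h Sum.inl_ne_inr
    · fin_cases i
      · exact (key _ _ _ (Sum.inl_injective h).symm).symm
      · exact absurd h Sum.inr_ne_inl
    · fin_cases i <;> fin_cases i'
      · rw [shrink_injective (Sum.inl_injective h)]
      · exact absurd h Sum.inl_ne_inr
      · exact absurd h Sum.inr_ne_inl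
      · obtain rfl : q = q' := Sum.inr_injective h
        rfl
  · rintro (c | c) (c' | ⟨z, y⟩) h
    · exact h.elim
    · obtain ⟨x, hx, hc⟩ := h
      obtain rfl : z = circleToDisk x := hx
      subst hc
      exact ⟨_, .inr ⟨1, circleToDisk x, y⟩, surgeryToTori_levelTorus_one m n x y, rfl,
        Quot.sound (surgeryRel_one m n x y)⟩
    · exact h.elim
    · exact h.elim

end GlAlexander

end

open GlAlexander in
theorem proposition5p1 {B : Type*} [Field B] [CharZero B] (G : Subgroup Bˣ)
    (hG : IsGoodPalette G) (m n : ℤ) :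
    IsLensSpace (hopfLink m n).Surgery (m * n - 1) n ∧
    (hopfDiagram m n).linkingMatrix = !![m, -1; -1, n] ∧
    ∀ (x₀ : (hopfLink m n).Surgery) (ω : H1 (hopfLink m n).Surgery x₀ →* G) (u v : G),
      u = ω (loopClass x₀ ((hopfLink m n).meridian 0)) →
      v = ω (loopClass x₀ ((hopfLink m n).meridian 1)) →
      u ≠ 1 → v ≠ 1 →
      (hopfDiagram m n).invariant ![(u : Bˣ), (v : Bˣ)] =
        (-1) ^ ((hopfDiagram m n).sigmaPos + 1) * d ((u : Bˣ) : B) * d ((v : Bˣ) : B) := by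
  refine ⟨isLensSpace_hopfLink_surgery m n, hopfDiagram_linkingMatrix m n, ?_⟩
  rintro x₀ ω u v hu hv - hv1
  have huv : u ^ m = v := by
    rw [hu, hv, ← map_zpow, meridian_zero_zpow]
  have hvu : v ^ n = u := by
    rw [hu, hv, ← map_zpow, meridian_one_zpow]
  have huv' : (u : Bˣ) ^ m = v := by rw [← huv, Subgroup.coe_zpow]
  have hvu' : (v : Bˣ) ^ n = u := by rw [← hvu, Subgroup.coe_zpow]
  have hv4 : (v : Bˣ) ^ 4 ≠ 1 := fun h =>
    hv1 (Subtype.ext (hG.eq_one_of_pow_four v v.2 h))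
  -- Elaborating this term against the goal directly makes unification unfold the invariant.
  have key := hopfDiagram_invariant (B := B) m n u v huv' hvu' hv4
  exact key
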